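/- Let $D$ be a division ring with center $C$ and $[D:C]=d^2<\infty$, and let $\sigma$ be an automorphism of $D$ of finite inner order $n\ge 1$, that is, $\sigma^n$ is an inner automorphism and $\sigma^i$ is not inner for $1\le i<n$. Let $u\in D^\times$ be such that $\sigma^n(a)=uau^{-1}$ for all $a\in D$ and $\sigma(u)=u$. Put $F=C\cap\mathrm{Fix}(\sigma)$ and let $R=D[t;\sigma]$ be the twisted polynomial ring, with $ta=\sigma(a)t$ for $a\in D$. For $f\in R$ of degree $m\geq 1$, the Petit algebra $S_f$ is the set of all $g\in R$ with $\deg g<m$, with the usual addition and with the product of $a$ and $b$ equal to the remainder of $ab$ on right division by $f$ (the unique $r$ with $\deg r<m$ and $ab-r\in Rf$); it is a unital nonassociative $F$-algebra. Its right nucleus $\mathrm{Nuc}_r(S_f)=\{x\in S_f : (ab)x=a(bx)\text{ for all }a,b\in S_f\}$ is an associative $F$-algebra. The minimal central left multiple of $f$ is $h(t)=\hat h(u^{-1}t^n)$, where $\hat h\in F[x]$ is the monic polynomial of least degree such that $\hat h(u^{-1}t^n)\in Rf$. Theorem. Let $f\in R$ be irreducible of degree $m>1$. Then $\hat h$ exists,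 is unique and is irreducible in $F[x]$, so that $E_{\hat h}=F[x]/(\hat h)$ is a field; all factorizations of $h$ into irreducible elements of $R$ have the same number $k$ of factors (and there is such a factorization); $Rh$ is a two-sided ideal; and $R/Rh$ and $\mathrm{Nuc}_r(S_f)$ are $E_{\hat h}$-algebras, extending their $F$-algebra structures, in which $x$ acts as the class of $u^{-1}t^n$ modulo $Rh$ and as the remainder of $u^{-1}t^n$ on right division by $f$, respectively. Moreover, there is a natural number $s$ with $ks=dn$ such that $\mathrm{Nuc}_r(S_f)$ is a central division algebra over $E_{\hat h}$ of degree $s$ (that is, of dimension $s^2$), and $$R/Rh\cong M_k(\mathrm{Nuc}_r(S_f))$$ as $E_{\hat h}$-algebras. Furthermore, $$\deg\hat h=\frac{md}{s},\qquad \deg h=\frac{mnd}{s},\qquad [\mathrm{Nuc}_r(S_f):F]=mds,$$ and $s$ divides $\gcd(md,dn)$. If $f$ is not right-invariant (that is, if $fR\not\subseteq Rf$), then $k>1$ and $s\neq dn$. -/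

import Mathlib

open scoped Polynomial

noncomputable section

set_option linter.unusedSectionVars false

/-! ### The right nucleus of a nonassociative algebra -/

/-- The right nucleus `{x | (a b) x = a (b x) for all a, b}` of a nonassociative unital ring. -/
def rightNucleus (A : Type*) [NonAssocRing A] : Subring A where
  carrier := {x | ∀ a b : A, a * b * x = a * (b * x)}
  mul_mem' {x y} hx hy a b := by
    have hx' : ∀ a b : A, a * b * x = a * (b * x) := hx
    have hy' : ∀ a b : A, a * b * y = a * (b * y) := hy
    calc a * b * (x * y) = a * b * x * y := (hy' _ _).symm
      _ = a * (b * x) * y := by rw [hx']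
      _ = a * (b * x * y) := hy' _ _
      _ = a * (b * (x * y)) := by rw [hy']
  one_mem' a b := by simp
  add_mem' {x y} hx hy a b := by
    have hx' : ∀ a b : A, a * b * x = a * (b * x) := hx
    have hy' : ∀ a b : A, a * b * y = a * (b * y) := hy
    simp only [mul_add, hx', hy']
  zero_mem' a b := by simp
  neg_mem' {x} hx a b := by
    have hx' : ∀ a b : A, a * b * x = a * (b * x) := hx
    simp only [mul_neg, hx']

/-- The right nucleus is an associative ring. -/
instance (A : Type*) [NonAssocRing A] : Ring (rightNucleus A) :=
  { (inferInstance : NonAssocRing (rightNucleus A)) with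
    mul_assoc := fun x y z => Subtype.ext (z.2 x y) }

section nucleusAlgebra

variable {K A : Type*} [CommRing K] [NonAssocRing A] [Module K A]
  [IsScalarTower K A A] [SMulCommClass K A A]

instance : SMul K (rightNucleus A) where
  smul c x := ⟨c • (x : A), fun a b => by
    have hx : ∀ a b : A, a * b * (x : A) = a * (b * x) := x.2
    simp only [mul_smul_comm, hx]⟩

instance : Module K (rightNucleus A) :=
  Function.Injective.module K (rightNucleus A).subtype.toAddMonoidHom Subtype.val_injective
    fun _ _ => rfl

/-- If `A` is a nonassociative algebra over `K`, its right nucleus is an associative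
algebra over `K`. -/
instance : Algebra K (rightNucleus A) :=
  Algebra.ofModule (fun c x y => Subtype.ext (smul_mul_assoc c (x : A) (y : A)))
    (fun c x y => Subtype.ext (mul_smul_comm c (x : A) (y : A)))

end nucleusAlgebra

/-! ### Automorphisms of finite inner order -/

/-- `σ` has finite inner order `n`: `σ ^ n` is inner and `σ ^ i` is outer for `1 ≤ i < n`. -/
def HasInnerOrder {D : Type*} [DivisionRing D] (σ : D ≃+* D) (n : ℕ) : Prop :=
  0 < n ∧ (∃ v : Dˣ, ∀ a : D, σ^[n] a = v * a * (v⁻¹ : Dˣ)) ∧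
    ∀ i : ℕ, 0 < i → i < n → ¬ ∃ v : Dˣ, ∀ a : D, σ^[i] a = v * a * (v⁻¹ : Dˣ)

/-! ### Skew polynomials over a division ring

`SkewPolynomial D` is the twisted polynomial ring `D[t;σ]`, with `t a = σ(a) t`, where the
endomorphism `σ = SkewPolynomial.φ` of `D` is given by the action of `Multiplicative ℕ`. -/

namespace SkewPolynomial

variable {D : Type*} [DivisionRing D]

/-- The degree of a skew polynomial, with `degree 0 = ⊥`. -/
def degree (f : SkewPolynomial D) : WithBot ℕ := f.support.max

/-- The degree of a skew polynomial as a natural number, with `natDegree 0 = 0`. -/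
def natDegree (f : SkewPolynomial D) : ℕ := f.degree.unbotD 0

lemma degree_lt_iff {f : SkewPolynomial D} {n : ℕ} :
    f.degree < n ↔ ∀ i, n ≤ i → f.coeff i = 0 := by
  have h0 : f.degree < n ↔ ∀ i ∈ f.support, ((i : ℕ) : WithBot ℕ) < n :=
    Finset.sup_lt_iff (WithBot.bot_lt_coe n)
  rw [h0]
  constructor
  · intro h i hi
    by_contra hc
    exact absurd (WithBot.coe_lt_coe.1 (h i (mem_support_iff.2 hc))) (not_lt.2 hi)
  · intro h i hi
    refine WithBot.coe_lt_coe.2 (lt_of_not_ge fun hle => mem_support_iff.1 hi (h i hle))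

lemma coeff_natDegree_ne_zero {f : SkewPolynomial D} (hf : f ≠ 0) :
    f.coeff f.natDegree ≠ 0 := by
  obtain ⟨n, hn⟩ := Finset.max_of_nonempty
    (Finset.nonempty_iff_ne_empty.2 (mt support_eq_empty.1 hf))
  have : f.natDegree = n := by rw [natDegree, degree, hn]; rfl
  rw [this]
  exact mem_support_iff.1 (Finset.mem_of_max hn)

lemma coeff_eq_zero_of_natDegree_lt {f : SkewPolynomial D} {i : ℕ} (hi : f.natDegree < i) :
    f.coeff i = 0 := by
  by_contra hc
  have h : (i : WithBot ℕ) ≤ f.degree := Finset.le_max (mem_support_iff.2 hc)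
  rw [natDegree] at hi
  cases hd : f.degree with
  | bot => rw [hd] at h; simp at h
  | coe n =>
    rw [hd] at h hi
    exact absurd (WithBot.coe_le_coe.1 h) (not_le.2 hi)

variable (D) in
/-- The skew polynomials of degree less than `n`. -/
def degreeLT (n : ℕ) : Submodule D (SkewPolynomial D) where
  carrier := {g | g.degree < n}
  add_mem' {a b} ha hb := degree_lt_iff.2 fun i hi => by
    rw [coeff_add, degree_lt_iff.1 ha i hi, degree_lt_iff.1 hb i hi, add_zero]
  zero_mem' := degree_lt_iff.2 fun i _ => coeff_zero i
  smul_mem' c a ha := degree_lt_iff.2 fun i hi => by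
    have h : (c • a).coeff i = c * a.coeff i := rfl
    rw [h, degree_lt_iff.1 ha i hi, mul_zero]

variable [MulSemiringAction (Multiplicative ℕ) D]

lemma coeff_monomial_mul (k i : ℕ) (c : D) (f : SkewPolynomial D) :
    (monomial k c * f).coeff (k + i) = c * φ^[k] (f.coeff i) := by
  rw [φ_iterate_apply]
  refine SkewMonoidAlgebra.coeff_single_mul_aux f fun a => ?_
  exact ⟨fun h => mul_left_cancel h, fun h => by rw [h]; rfl⟩

lemma coeff_mul_natDegree_add (q f : SkewPolynomial D) :
    (q * f).coeff (q.natDegree + f.natDegree) =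
      q.coeff q.natDegree * φ^[q.natDegree] (f.coeff f.natDegree) := by
  have h1 : ∀ p : SkewPolynomial D, (p * f).coeff (q.natDegree + f.natDegree) =
      p.sum fun k c => (monomial k c * f).coeff (q.natDegree + f.natDegree) := fun p => by
    conv_lhs => rw [← sum_monomial p, sum_def, Finset.sum_mul]
    rw [sum_def]
    exact map_sum (AddMonoidHom.mk' (fun g : SkewPolynomial D =>
      g.coeff (q.natDegree + f.natDegree)) fun a b => coeff_add a b _) _ _
  rw [h1, sum_def, Finset.sum_eq_single q.natDegree]
  · exact coeff_monomial_mul _ _ _ _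
  · intro k hk hne
    have hlt : k < q.natDegree := lt_of_le_of_ne (le_of_not_gt fun hgt =>
      mem_support_iff.1 hk (coeff_eq_zero_of_natDegree_lt hgt)) hne
    obtain ⟨j, hj⟩ := Nat.exists_eq_add_of_lt hlt
    have : q.natDegree + f.natDegree = k + (f.natDegree + j + 1) := by omega
    rw [this, coeff_monomial_mul, coeff_eq_zero_of_natDegree_lt (f := f) (by omega),
      iterate_map_zero, mul_zero]
  · intro h
    rw [notMem_support_iff.1 h, monomial_zero_right, zero_mul, coeff_zero]

lemma eq_zero_of_degree_mul_lt {q f : SkewPolynomial D} (hf : f ≠ 0)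
    (h : (q * f).degree < f.natDegree) : q = 0 := by
  by_contra hq
  have h1 := degree_lt_iff.1 h (q.natDegree + f.natDegree) (Nat.le_add_left _ _)
  rw [coeff_mul_natDegree_add] at h1
  rcases mul_eq_zero.1 h1 with h2 | h2
  · exact coeff_natDegree_ne_zero hq h2
  · exact coeff_natDegree_ne_zero hf
      ((RingHom.injective (φ : D →+* D)).iterate _ (h2.trans (iterate_map_zero φ _).symm))

lemma exists_rem {f : SkewPolynomial D} (hf : f ≠ 0) (g : SkewPolynomial D) :
    ∃ r : SkewPolynomial D, r.degree < f.natDegree ∧ ∃ q, g = q * f + r := by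
  suffices H : ∀ (N : ℕ) (g : SkewPolynomial D), g.degree < (N : ℕ) →
      ∃ r : SkewPolynomial D, r.degree < f.natDegree ∧ ∃ q, g = q * f + r from
    H (g.natDegree + 1) g (degree_lt_iff.2 fun i hi => coeff_eq_zero_of_natDegree_lt hi)
  intro N
  induction N with
  | zero =>
    intro g hg
    refine ⟨g, degree_lt_iff.2 fun i _ => degree_lt_iff.1 hg i (Nat.zero_le i), 0, by simp⟩
  | succ N ih =>
    intro g hg
    by_cases hN : N < f.natDegree
    · exact ⟨g, degree_lt_iff.2 fun i hi => degree_lt_iff.1 hg i (by omega), 0, by simp⟩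
    obtain ⟨k, rfl⟩ := Nat.exists_eq_add_of_le' (not_lt.1 hN)
    set b := φ^[k] (f.coeff f.natDegree) with hb
    have hb0 : b ≠ 0 := fun h2 => coeff_natDegree_ne_zero hf
      ((RingHom.injective (φ : D →+* D)).iterate _ (h2.trans (iterate_map_zero φ _).symm))
    set p : SkewPolynomial D := monomial k (g.coeff (k + f.natDegree) * b⁻¹) with hp
    obtain ⟨r, hr, q, hq⟩ := ih (g - p * f) (degree_lt_iff.2 fun i hi => by
      obtain ⟨j, rfl⟩ := Nat.exists_eq_add_of_le hi
      rw [coeff_sub, add_assoc, hp, coeff_monomial_mul]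
      rcases Nat.eq_zero_or_pos j with rfl | hj
      · rw [add_zero, ← hb, mul_assoc, inv_mul_cancel₀ hb0, mul_one, sub_self]
      · rw [degree_lt_iff.1 hg _ (by omega), coeff_eq_zero_of_natDegree_lt (f := f) (by omega),
          iterate_map_zero, mul_zero, sub_zero])
    exact ⟨r, hr, q + p, by rw [add_mul, add_right_comm, ← hq, sub_add_cancel]⟩

open Classical in
/-- The remainder of `g` on right division by `f ≠ 0`: the unique `r` with `deg r < deg f` and
`g = q f + r` for some `q` (and `0` if `f = 0`). -/
def rightRem (f g : SkewPolynomial D) : SkewPolynomial D :=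
  if hf : f = 0 then 0 else (exists_rem hf g).choose

lemma degree_rightRem_lt (f g : SkewPolynomial D) : (rightRem f g).degree < f.natDegree := by
  by_cases hf : f = 0
  · rw [rightRem, dif_pos hf]
    exact degree_lt_iff.2 fun i _ => coeff_zero i
  · rw [rightRem, dif_neg hf]
    exact (exists_rem hf g).choose_spec.1

lemma exists_eq_mul_add_rightRem {f : SkewPolynomial D} (hf : f ≠ 0) (g : SkewPolynomial D) :
    ∃ q, g = q * f + rightRem f g := by
  rw [rightRem, dif_neg hf]
  exact (exists_rem hf g).choose_spec.2

lemma rightRem_eq {f g q r : SkewPolynomial D} (hf : f ≠ 0) (hr : r.degree < f.natDegree)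
    (h : g = q * f + r) : rightRem f g = r := by
  obtain ⟨q', hq'⟩ := exists_eq_mul_add_rightRem hf g
  have h1 : (q' - q) * f = r - rightRem f g := by
    rw [sub_mul, sub_eq_sub_iff_add_eq_add, ← hq', h, add_comm]
  have h2 : q' - q = 0 := eq_zero_of_degree_mul_lt hf (by
    rw [h1]
    exact (degreeLT D f.natDegree).sub_mem hr (degree_rightRem_lt f g))
  rw [h2, zero_mul] at h1
  exact (sub_eq_zero.1 h1.symm).symm

lemma rightRem_of_degree_lt {f g : SkewPolynomial D} (hg : g.degree < f.natDegree) :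
    rightRem f g = g := by
  by_cases hf : f = 0
  · subst hf
    have : g = 0 := ext fun i => degree_lt_iff.1 hg i (Nat.zero_le i)
    rw [this, rightRem, dif_pos rfl]
  · exact rightRem_eq hf hg (q := 0) (by simp)

lemma rightRem_add (f a b : SkewPolynomial D) :
    rightRem f (a + b) = rightRem f a + rightRem f b := by
  by_cases hf : f = 0
  · simp [rightRem, hf]
  obtain ⟨q, hq⟩ := exists_eq_mul_add_rightRem hf a
  obtain ⟨q', hq'⟩ := exists_eq_mul_add_rightRem hf b
  refine rightRem_eq hf ((degreeLT D f.natDegree).add_mem (degree_rightRem_lt f a)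
    (degree_rightRem_lt f b)) (q := q + q') ?_
  conv_lhs => rw [hq, hq']
  rw [add_mul, add_add_add_comm]

lemma rightRem_zero (f : SkewPolynomial D) : rightRem f 0 = 0 :=
  rightRem_of_degree_lt (degree_lt_iff.2 fun i _ => coeff_zero i)

lemma rightRem_one {f : SkewPolynomial D} (hf : 0 < f.natDegree) : rightRem f 1 = 1 :=
  rightRem_of_degree_lt (degree_lt_iff.2 fun i hi => by rw [coeff_one, if_neg (by omega)])

/-- `f` is right-invariant if `f R ⊆ R f`. -/
def IsRightInvariant (f : SkewPolynomial D) : Prop :=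
  ∀ g : SkewPolynomial D, ∃ q : SkewPolynomial D, f * g = q * f

/-- `h` has a factorization into irreducible factors, and every such factorization has
exactly `k` factors. -/
def HasFactorCount (h : SkewPolynomial D) (k : ℕ) : Prop :=
  (∃ L : List (SkewPolynomial D), (∀ p ∈ L, Irreducible p) ∧ L.prod = h) ∧
    ∀ L : List (SkewPolynomial D), (∀ p ∈ L, Irreducible p) → L.prod = h → L.length = k

/-! ### The field `F` of central elements of `D` fixed by `σ` -/

variable (D) in
/-- The field `F = C ∩ Fix(σ)`, where `C` is the center of `D`. -/
def fixedCenter : Subfield (Subring.center D) where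
  carrier := {c | φ (c : D) = c}
  mul_mem' {a b} ha hb := by
    have ha' : φ (a : D) = a := ha
    have hb' : φ (b : D) = b := hb
    show φ ((a * b : Subring.center D) : D) = (a * b : Subring.center D)
    rw [Subring.coe_mul, map_mul, ha', hb']
  one_mem' := map_one φ
  add_mem' {a b} ha hb := by
    have ha' : φ (a : D) = a := ha
    have hb' : φ (b : D) = b := hb
    show φ ((a + b : Subring.center D) : D) = (a + b : Subring.center D)
    rw [Subring.coe_add, map_add, ha', hb']
  zero_mem' := map_zero φ
  neg_mem' {a} ha := by
    have ha' : φ (a : D) = a := ha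
    show φ ((-a : Subring.center D) : D) = (-a : Subring.center D)
    rw [Subring.coe_neg, map_neg, ha']
  inv_mem' a ha := by
    have ha' : φ (a : D) = a := ha
    show φ ((a⁻¹ : Subring.center D) : D) = (a⁻¹ : Subring.center D)
    rw [Subring.center.coe_inv, map_inv₀, ha']

variable (D) in
/-- The field `F = C ∩ Fix(σ)`, as a type. -/
def FixedCenter : Type _ := fixedCenter D

instance : Field (FixedCenter D) := inferInstanceAs (Field (fixedCenter D))

instance : Algebra (FixedCenter D) D := inferInstanceAs (Algebra (fixedCenter D) D)

instance : SMulCommClass (Multiplicative ℕ) (FixedCenter D) D where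
  smul_comm k c x := by
    have hc : φ (algebraMap (FixedCenter D) D c) = algebraMap (FixedCenter D) D c := c.2
    have hk : k • algebraMap (FixedCenter D) D c = algebraMap (FixedCenter D) D c := by
      rw [← ofAdd_toAdd k, ← φ_iterate_apply]
      exact Function.iterate_fixed hc _
    rw [Algebra.smul_def, Algebra.smul_def, smul_mul', hk]

lemma rightRem_smul (f a : SkewPolynomial D) (c : FixedCenter D) :
    rightRem f (c • a) = c • rightRem f a := by
  by_cases hf : f = 0
  · simp [rightRem, hf]
  obtain ⟨q, hq⟩ := exists_eq_mul_add_rightRem hf a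
  refine rightRem_eq hf ((degreeLT D f.natDegree).smul_of_tower_mem c (degree_rightRem_lt f a))
    (q := c • q) ?_
  conv_lhs => rw [hq]
  rw [smul_add, smul_mul_assoc]

/-! ### Petit algebras -/

/-- The Petit algebra `S_f`: the skew polynomials of degree less than `deg f`, with the
multiplication sending `(a, b)` to the remainder of `a b` on right division by `f`. -/
def PetitAlgebra (f : SkewPolynomial D) : Type _ := degreeLT D f.natDegree

namespace PetitAlgebra

variable {f : SkewPolynomial D}

instance : AddCommGroup (PetitAlgebra f) :=
  inferInstanceAs (AddCommGroup (degreeLT D f.natDegree))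

instance : Module (FixedCenter D) (PetitAlgebra f) :=
  inferInstanceAs (Module (FixedCenter D) (degreeLT D f.natDegree))

/-- The skew polynomial of degree less than `deg f` underlying an element of `S_f`. -/
def toPoly (a : PetitAlgebra f) : SkewPolynomial D := Subtype.val a

variable (f) in
/-- The class in `S_f` of a skew polynomial, i.e. its remainder on right division by `f`. -/
def mk (g : SkewPolynomial D) : PetitAlgebra f := ⟨rightRem f g, degree_rightRem_lt f g⟩

lemma toPoly_injective : Function.Injective (toPoly : PetitAlgebra f → SkewPolynomial D) :=
  Subtype.val_injective

instance : Mul (PetitAlgebra f) where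
  mul a b := mk f (a.toPoly * b.toPoly)

-- `1` is its own remainder as soon as `0 < deg f`.
instance : One (PetitAlgebra f) where
  one := mk f 1

lemma toPoly_mul (a b : PetitAlgebra f) :
    (a * b).toPoly = rightRem f (a.toPoly * b.toPoly) := rfl

lemma toPoly_add (a b : PetitAlgebra f) : (a + b).toPoly = a.toPoly + b.toPoly := rfl

lemma toPoly_smul (c : FixedCenter D) (a : PetitAlgebra f) : (c • a).toPoly = c • a.toPoly := rfl

lemma toPoly_zero : (0 : PetitAlgebra f).toPoly = 0 := rfl

lemma rightRem_toPoly (a : PetitAlgebra f) : rightRem f a.toPoly = a.toPoly :=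
  rightRem_of_degree_lt a.2

lemma toPoly_one (hf : 0 < f.natDegree) : (1 : PetitAlgebra f).toPoly = 1 := rightRem_one hf

lemma eq_of_natDegree_eq_zero (hf : f.natDegree = 0) (a b : PetitAlgebra f) : a = b := by
  have h : ∀ a : PetitAlgebra f, a.toPoly = 0 := fun a => SkewPolynomial.ext fun i =>
    degree_lt_iff.1 (show a.toPoly.degree < f.natDegree from a.2) i (by omega)
  exact toPoly_injective ((h a).trans (h b).symm)

instance : NonAssocRing (PetitAlgebra f) :=
  { (inferInstance : AddCommGroup (PetitAlgebra f)),
    (inferInstance : Mul (PetitAlgebra f)), (inferInstance : One (PetitAlgebra f)) with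
    left_distrib := fun a b c => toPoly_injective (by
      simp only [toPoly_add, toPoly_mul, mul_add, rightRem_add])
    right_distrib := fun a b c => toPoly_injective (by
      simp only [toPoly_add, toPoly_mul, add_mul, rightRem_add])
    zero_mul := fun a => toPoly_injective (by
      simp only [toPoly_mul, toPoly_zero, zero_mul, rightRem_zero])
    mul_zero := fun a => toPoly_injective (by
      simp only [toPoly_mul, toPoly_zero, mul_zero, rightRem_zero])
    one_mul := fun a => by
      rcases Nat.eq_zero_or_pos f.natDegree with hf | hf
      · exact eq_of_natDegree_eq_zero hf _ _
      · exact toPoly_injective (by rw [toPoly_mul, toPoly_one hf, one_mul, rightRem_toPoly])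
    mul_one := fun a => by
      rcases Nat.eq_zero_or_pos f.natDegree with hf | hf
      · exact eq_of_natDegree_eq_zero hf _ _
      · exact toPoly_injective (by rw [toPoly_mul, toPoly_one hf, mul_one, rightRem_toPoly]) }

instance : IsScalarTower (FixedCenter D) (PetitAlgebra f) (PetitAlgebra f) where
  smul_assoc c a b := toPoly_injective (by
    simp only [smul_eq_mul, toPoly_mul, toPoly_smul, smul_mul_assoc, rightRem_smul])

instance : SMulCommClass (FixedCenter D) (PetitAlgebra f) (PetitAlgebra f) where
  smul_comm c a b := toPoly_injective (by
    simp only [smul_eq_mul, toPoly_mul, toPoly_smul, mul_smul_comm, rightRem_smul])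

end PetitAlgebra

/-! ### The minimal central left multiple -/

/-- The element `u⁻¹ t ^ n` of `D[t;σ]`. -/
def centralGen (u : Dˣ) (n : ℕ) : SkewPolynomial D := C ((u⁻¹ : Dˣ) : D) * X ^ n

/-- `ĥ ∈ F[x]` gives the minimal central left multiple `ĥ(u⁻¹ t ^ n)` of `f`: it is monic of
minimal degree such that `f` divides `ĥ(u⁻¹ t ^ n)` on the right. -/
def IsMinCentralLeftMultiple (u : Dˣ) (n : ℕ) (f : SkewPolynomial D)
    (hhat : (FixedCenter D)[X]) : Prop :=
  hhat.Monic ∧ (∃ g : SkewPolynomial D, Polynomial.aeval (centralGen u n) hhat = g * f) ∧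
    ∀ p : (FixedCenter D)[X], p.Monic →
      (∃ g : SkewPolynomial D, Polynomial.aeval (centralGen u n) p = g * f) → hhat.natDegree ≤ p.natDegree

end SkewPolynomial

end

/-! Everything is read off the left module `V = R/Rf`. Since `R` is a domain in which left ideals
are principal, irreducibility of `f` makes `V` simple. Right multiplication by `x` is well defined
on `V` exactly when `fx ∈ Rf`, and for `m > 1` this is the condition for `x` to lie in the right
nucleus (`mem_rightNucleus_iff`). Hence the nucleus is `End_R(V)ᵒᵖ` (`nucleusEquiv`), a division
ring by Schur's lemma.

The element `z = u⁻¹tⁿ` is central in `R`, and `ĥ` is its minimal polynomial on `V`: it exists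
because `V` is finite-dimensional over `F`, and it is irreducible because `V` is simple. As `m > 1`,
`t` acts injectively on the class of `1`, so `ĥ(0) ≠ 0`. Nonzero two-sided ideals of `R` have the
form `R p(z) t^r` (`exists_eq_span_of_isTwoSided`), so `Rh` is a maximal two-sided ideal. Now `V`
embeds in `R/Rh`, and its isotypic component there is a nonzero two-sided ideal, hence everything:
`R/Rh ≅ V^k` as left modules (`exists_linearEquiv_fun_of_maximal_twoSided`). Taking opposite
endomorphism rings gives `R/Rh ≅ M_k(End(V)ᵒᵖ)`; comparing lengths shows that `k` counts irreducible
factors, and comparing `D`-dimensions gives `n deg ĥ = km`.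

The numerical statements follow from `[D:F] = nd²` (`finite_and_finrank_eq`), proved by Artin's
theorem on the center and an independence argument of Dedekind type for the maps `x ↦ σ^i(x) b_j`.
It makes `R/Rh` of dimension `(dn)²` over `E`, so `k²` divides `(dn)²` and `s = dn/k`. The center of
`R/Rh` is `E` by `exists_sub_aeval_mem_of_commute`, and centrality passes from the matrix ring to
the nucleus. -/

noncomputable section

set_option linter.unusedSectionVars false

/-! ### Quotients of noncommutative rings by left ideals -/

section leftQuotient

open MulOpposite

variable {R : Type*} [Ring R]

/-- The quotient of a ring by a two-sided ideal is the opposite of its ring of endomorphisms as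
a left module. -/
def quotientEndEquiv (I : Ideal R) [I.IsTwoSided] : (R ⧸ I) ≃+* (Module.End R (R ⧸ I))ᵐᵒᵖ where
  toFun x := op
    { toFun := fun y => y * x
      map_add' := fun a b => add_mul a b x
      map_smul' := fun r y => by
        obtain ⟨y, rfl⟩ := Ideal.Quotient.mk_surjective y
        obtain ⟨x, rfl⟩ := Ideal.Quotient.mk_surjective x
        exact congrArg (Ideal.Quotient.mk I) (mul_assoc r y x) }
  invFun φ := φ.unop 1
  left_inv x := one_mul x
  right_inv φ := unop_injective <| LinearMap.ext fun y => by
    obtain ⟨y, rfl⟩ := Ideal.Quotient.mk_surjective y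
    obtain ⟨x, hx⟩ := Ideal.Quotient.mk_surjective (φ.unop 1)
    have h : Ideal.Quotient.mk I y = y • (1 : R ⧸ I) :=
      congrArg (Ideal.Quotient.mk I) (mul_one y).symm
    change Ideal.Quotient.mk I y * φ.unop 1 = φ.unop (Ideal.Quotient.mk I y)
    rw [h, map_smul, ← h, ← hx]
    rfl
  map_mul' x y := unop_injective <| LinearMap.ext fun z => (mul_assoc z x y).symm
  map_add' x y := unop_injective <| LinearMap.ext fun z => mul_add z x y

variable {V : Type*} [AddCommGroup V] [Module R V]

/-- A ring which is a power of a left module `V` is a matrix ring over `(End V)ᵐᵒᵖ`. -/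
def quotientMatrixEquiv {I : Ideal R} [I.IsTwoSided] {ι : Type*} [Fintype ι] [DecidableEq ι]
    (e : (R ⧸ I) ≃ₗ[R] (ι → V)) : (R ⧸ I) ≃+* Matrix ι ι (Module.End R V)ᵐᵒᵖ :=
  (quotientEndEquiv I).trans <|
    (RingEquiv.op (e.conjRingEquiv.trans (endVecRingEquivMatrixEnd ι R V))).trans
      RingEquiv.mopMatrix.symm

/-- A central element acts in the same way on every copy of `V`. This makes the matrix isomorphism
linear over the central field, not merely a ring isomorphism. -/
lemma quotientMatrixEquiv_mk_of_commute {I : Ideal R} [I.IsTwoSided] {ι : Type*} [Fintype ι]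
    [DecidableEq ι] (e : (R ⧸ I) ≃ₗ[R] (ι → V)) {c : R} (hc : ∀ r, c * r = r * c)
    {φ : Module.End R V} (hφ : ∀ v, φ v = c • v) :
    quotientMatrixEquiv e (Ideal.Quotient.mk I c) = Matrix.diagonal fun _ => op φ := by
  have h1 : ∀ y : R ⧸ I, y * Ideal.Quotient.mk I c = c • y := fun y => by
    obtain ⟨y, rfl⟩ := Ideal.Quotient.mk_surjective y
    exact congrArg (Ideal.Quotient.mk I) (hc y).symm
  ext i j
  refine unop_injective (LinearMap.ext fun v => ?_)
  change e (e.symm (Pi.single i v) * Ideal.Quotient.mk I c) j = _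
  rw [h1, map_smul, e.apply_symm_apply]
  by_cases hij : i = j
  · subst hij
    simp [hφ]
  · simp [Matrix.diagonal_apply_ne _ hij, Pi.single_eq_of_ne (Ne.symm hij)]

/-- The `V`-isotypic component of `R/I` is stable under all endomorphisms, in particular under right
multiplications, so its preimage in `R` is a two-sided ideal above `I`. A nonzero `φ` is injective
on the simple module `V`, so the component is nonzero and by maximality is all of `R/I`; being
cyclic, `R/I` is then a finite power of `V`. -/
lemma exists_linearEquiv_fun_of_maximal_twoSided {I : Ideal R} [I.IsTwoSided]
    (hI : ∀ J : Ideal R, J.IsTwoSided → I ≤ J → J = I ∨ J = ⊤) [IsSimpleModule R V]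
    {φ : V →ₗ[R] R ⧸ I} (hφ : φ ≠ 0) : ∃ k : ℕ, Nonempty ((R ⧸ I) ≃ₗ[R] (Fin k → V)) := by
  set T := isotypicComponent R (R ⧸ I) V
  have hT : T ≠ ⊥ := by
    have hinj := (LinearMap.injective_or_eq_zero φ).resolve_right hφ
    have hle : LinearMap.range φ ≤ T := le_sSup ⟨(LinearEquiv.ofInjective φ hinj).symm⟩
    intro h
    rw [h, le_bot_iff, LinearMap.range_eq_bot] at hle
    exact hφ hle
  have hinv : T.IsFullyInvariant := .isotypicComponent R _ V
  have htop : T = ⊤ := by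
    have h2 : Ideal.IsTwoSided (T.comap I.mkQ) := ⟨fun {a} b ha =>
      hinv ((quotientEndEquiv I (Ideal.Quotient.mk I b)).unop) ha⟩
    have hle : I ≤ T.comap I.mkQ := fun x hx => by
      rw [Submodule.mem_comap, Submodule.mkQ_apply, (Submodule.Quotient.mk_eq_zero I).2 hx]
      exact T.zero_mem
    have hmap : (T.comap I.mkQ).map I.mkQ = T :=
      Submodule.map_comap_eq_of_surjective I.mkQ_surjective T
    rcases hI _ h2 hle with h | h
    · rw [h, Submodule.mkQ_map_self] at hmap
      exact absurd hmap.symm hT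
    · rw [← hmap, h, Submodule.map_top, Submodule.range_mkQ]
  have hss : IsSemisimpleModule R (R ⧸ I) := by
    have : IsSemisimpleModule R T := inferInstance
    rw [htop] at this
    exact .congr Submodule.topEquiv.symm
  exact (IsIsotypicOfType.of_isotypicComponent_eq_top htop).linearEquiv_fun

/-- Right multiplication by `g`, as a linear map `R / R a → R / R b`. -/
def mulRightQuotient {a b : R} (g : R) (h : a * g ∈ Ideal.span {b}) :
    (R ⧸ Ideal.span {a}) →ₗ[R] R ⧸ Ideal.span {b} :=
  Submodule.mapQ (Ideal.span {a} : Ideal R) (Ideal.span {b} : Ideal R)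
    (LinearMap.toSpanSingleton R R g) <| by
      rw [Ideal.span, Submodule.span_le, Set.singleton_subset_iff]
      exact h

lemma mulRightQuotient_mk {a b g : R} (h : a * g ∈ Ideal.span {b}) (r : R) :
    mulRightQuotient g h (Submodule.Quotient.mk r) = Submodule.Quotient.mk (r * g) := rfl

/-- Length is additive on `0 → R/Ra → R/Rab → R/Rb → 0`, whose first map is right multiplication by
`b`; cancelling `b` gives injectivity. -/
lemma length_quotient_span_mul [NoZeroDivisors R] (a : R) {b : R} (hb : b ≠ 0) :
    Module.length R (R ⧸ Ideal.span {a * b}) =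
      Module.length R (R ⧸ Ideal.span {a}) + Module.length R (R ⧸ Ideal.span {b}) := by
  have hle : (Ideal.span {a * b} : Ideal R) ≤ Ideal.span {b} :=
    (Ideal.span_singleton_le_iff_mem _).2 (Ideal.mem_span_singleton'.2 ⟨a, rfl⟩)
  refine Module.length_eq_add_of_exact
    (mulRightQuotient b (Ideal.mem_span_singleton_self (a * b)))
    (Submodule.factor hle) ?_ (Submodule.factor_surjective hle) ?_
  · rw [← LinearMap.ker_eq_bot, LinearMap.ker_eq_bot']
    intro x
    obtain ⟨x, rfl⟩ := Submodule.mkQ_surjective _ x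
    intro h
    rw [Submodule.mkQ_apply, mulRightQuotient_mk, Submodule.Quotient.mk_eq_zero] at h
    obtain ⟨c, hc⟩ := Ideal.mem_span_singleton'.1 h
    rw [← mul_assoc] at hc
    rw [Submodule.mkQ_apply, Submodule.Quotient.mk_eq_zero]
    exact Ideal.mem_span_singleton'.2 ⟨c, mul_right_cancel₀ hb hc⟩
  · intro x
    obtain ⟨x, rfl⟩ := Submodule.mkQ_surjective _ x
    have hfac : Submodule.factor hle (Submodule.Quotient.mk x) = Submodule.Quotient.mk x := rfl
    rw [Submodule.mkQ_apply, hfac, Submodule.Quotient.mk_eq_zero]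
    constructor
    · intro h
      obtain ⟨c, hc⟩ := Ideal.mem_span_singleton'.1 h
      exact ⟨Submodule.Quotient.mk c, by rw [mulRightQuotient_mk, hc]⟩
    · rintro ⟨y, hy⟩
      obtain ⟨y, rfl⟩ := Submodule.mkQ_surjective _ y
      rw [Submodule.mkQ_apply, mulRightQuotient_mk, Submodule.Quotient.eq] at hy
      have h1 : y * b ∈ Ideal.span {b} := Ideal.mem_span_singleton'.2 ⟨y, rfl⟩
      have := Ideal.sub_mem _ h1 (hle hy)
      rwa [sub_sub_cancel] at this

lemma isCoatom_span_singleton_of_irreducible [IsDomain R] [IsPrincipalIdealRing R] {f : R}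
    (hf : Irreducible f) : IsCoatom (Ideal.span {f} : Ideal R) := by
  -- In a domain one-sided inverses are two-sided, so a proper left ideal contains no
  -- left-invertible or right-invertible element.
  have key : ∀ {x y : R}, x * y = 1 → y * x = 1 := fun {x y} h => by
    have hx : x ≠ 0 := left_ne_zero_of_mul_eq_one h
    refine mul_left_cancel₀ hx ?_
    rw [← mul_assoc, h, one_mul, mul_one]
  constructor
  · intro h
    obtain ⟨c, hc⟩ := Ideal.mem_span_singleton'.1 ((Ideal.eq_top_iff_one _).1 h)
    exact hf.not_isUnit ⟨⟨f, c, key hc, hc⟩, rfl⟩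
  · intro J hJ
    obtain ⟨g, rfl⟩ := IsPrincipalIdealRing.principal J
    obtain ⟨a, ha⟩ := Ideal.mem_span_singleton'.1 (hJ.le (Ideal.mem_span_singleton_self f))
    rcases hf.isUnit_or_isUnit ha.symm with ⟨v, hv⟩ | ⟨v, hv⟩
    · refine absurd ((Ideal.span_singleton_le_iff_mem _).2 ?_) hJ.not_ge
      exact Ideal.mem_span_singleton'.2 ⟨(v⁻¹ : Rˣ), by rw [← ha, ← hv, Units.inv_mul_cancel_left]⟩
    · refine (Ideal.eq_top_iff_one _).2 (Ideal.mem_span_singleton'.2 ⟨(v⁻¹ : Rˣ), ?_⟩)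
      rw [← hv, Units.inv_mul]

lemma isSimpleModule_quotient_of_irreducible [IsDomain R] [IsPrincipalIdealRing R] {f : R}
    (hf : Irreducible f) : IsSimpleModule R (R ⧸ Ideal.span {f}) :=
  isSimpleModule_iff_isCoatom.2 (isCoatom_span_singleton_of_irreducible hf)

/-- Each irreducible factor contributes one simple module, so the number of factors is a module
length and does not depend on the factorization. -/
lemma length_quotient_span_prod [IsDomain R] [IsPrincipalIdealRing R] (L : List R)
    (hL : ∀ p ∈ L, Irreducible p) :
    Module.length R (R ⧸ Ideal.span {L.prod}) = L.length := by
  induction L with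
  | nil =>
    rw [List.prod_nil, Ideal.span_singleton_one, List.length_nil, Nat.cast_zero,
      Module.length_eq_zero_iff]
    exact Submodule.Quotient.subsingleton_iff.2 rfl
  | cons p L ih =>
    have h0 : L.prod ≠ 0 := List.prod_ne_zero fun h =>
      (hL 0 (List.mem_cons_of_mem _ h)).ne_zero rfl
    have := isSimpleModule_quotient_of_irreducible (hL p List.mem_cons_self)
    rw [List.prod_cons, length_quotient_span_mul p h0, Module.length_eq_one,
      ih fun q hq => hL q (List.mem_cons_of_mem _ hq), List.length_cons, Nat.cast_add,
      Nat.cast_one, add_comm]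

end leftQuotient

namespace SkewPolynomial

/-! ### Basic properties of skew polynomials over a division ring -/

section basic

variable {D : Type*} [DivisionRing D]

/-- Positivity of `n` takes care of `f = 0`, where `natDegree` is `0` but `degree` is `⊥`. -/
lemma natDegree_lt_iff {f : SkewPolynomial D} {n : ℕ} (hn : 0 < n) :
    f.natDegree < n ↔ f.degree < n := by
  rw [degree_lt_iff]
  constructor
  · intro h i hi
    exact coeff_eq_zero_of_natDegree_lt (h.trans_le hi)
  · intro h
    by_contra! hc
    by_cases hf : f = 0
    · subst hf
      exact absurd hc (not_le.2 hn)
    · exact coeff_natDegree_ne_zero hf (h _ hc)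

lemma degree_lt_natDegree_succ (f : SkewPolynomial D) : f.degree < (f.natDegree + 1 : ℕ) :=
  degree_lt_iff.2 fun _ hi => coeff_eq_zero_of_natDegree_lt hi

lemma natDegree_eq_of_coeff {f : SkewPolynomial D} {n : ℕ} (h : f.coeff n ≠ 0)
    (h' : ∀ i, n < i → f.coeff i = 0) : f.natDegree = n := by
  refine le_antisymm (not_lt.1 fun hlt => ?_) (not_lt.1 fun hlt => h
    (coeff_eq_zero_of_natDegree_lt hlt))
  have hf : f ≠ 0 := fun h0 => h (by rw [h0, coeff_zero])
  exact coeff_natDegree_ne_zero hf (h' _ hlt)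

lemma eq_C_of_natDegree_eq_zero {f : SkewPolynomial D} (h : f.natDegree = 0) :
    f = C (f.coeff 0) := by
  refine SkewPolynomial.ext fun i => ?_
  rcases Nat.eq_zero_or_pos i with rfl | hi
  · rw [coeff_C_zero]
  · rw [coeff_C_ne_zero hi.ne', coeff_eq_zero_of_natDegree_lt (h.trans_lt hi)]

lemma natDegree_C (a : D) : (C a : SkewPolynomial D).natDegree = 0 := by
  by_contra hc
  have h0 : (C a : SkewPolynomial D) ≠ 0 := fun h => hc (by rw [h]; rfl)
  exact coeff_natDegree_ne_zero h0 (coeff_C_ne_zero hc)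

variable [MulSemiringAction (Multiplicative ℕ) D]

lemma natDegree_one : (1 : SkewPolynomial D).natDegree = 0 := natDegree_C 1

lemma coeff_smul (c : D) (f : SkewPolynomial D) (i : ℕ) : (c • f).coeff i = c * f.coeff i := rfl

lemma coeff_C_mul (c : D) (f : SkewPolynomial D) (i : ℕ) : (C c * f).coeff i = c * f.coeff i :=
  SkewMonoidAlgebra.coeff_single_one_mul f c _

lemma coeff_mul_C (f : SkewPolynomial D) (c : D) (i : ℕ) :
    (f * C c).coeff i = f.coeff i * φ^[i] c := by
  rw [φ_iterate_apply]
  exact SkewMonoidAlgebra.coeff_mul_single_one f c _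

lemma coeff_mul_X_succ (f : SkewPolynomial D) (i : ℕ) : (f * X).coeff (i + 1) = f.coeff i := by
  have h := SkewMonoidAlgebra.coeff_mul_single_aux f (r := (1 : D)) (x := Multiplicative.ofAdd 1)
    (y := Multiplicative.ofAdd i) (z := Multiplicative.ofAdd (i + 1))
    fun a => ⟨fun h => mul_right_cancel h, fun h => by rw [h]; rfl⟩
  rw [smul_one, mul_one] at h
  exact h

lemma coeff_mul_X_zero (f : SkewPolynomial D) : (f * X).coeff 0 = 0 :=
  SkewMonoidAlgebra.coeff_mul_single_of_not_exists_mul (1 : D) f fun _ h =>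
    absurd (congrArg Multiplicative.toAdd h) (Nat.succ_ne_zero _).symm

lemma coeff_X_mul_succ (f : SkewPolynomial D) (i : ℕ) :
    (X * f).coeff (i + 1) = φ (f.coeff i) := by
  have h := coeff_monomial_mul 1 i (1 : D) f
  rw [one_mul, add_comm] at h
  exact h

lemma coeff_X_mul_zero (f : SkewPolynomial D) : (X * f).coeff 0 = 0 :=
  SkewMonoidAlgebra.coeff_single_mul_of_not_exists_mul (1 : D) f fun ⟨x, h⟩ =>
    absurd (congrArg Multiplicative.toAdd h) (by
      rw [toAdd_mul]; exact (Nat.ne_of_lt (by simp)))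

lemma X_mul_C (c : D) : X * C c = C (φ c) * X := by
  rw [C_mul_X_eq_monomial, ← monomial_zero_left, X_mul_monomial]

lemma X_pow_mul_C (k : ℕ) (c : D) : X ^ k * C c = C (φ^[k] c) * X ^ k := by
  rw [C_mul_X_pow_eq_monomial, ← monomial_zero_left, X_pow_mul_monomial, zero_add]

lemma φ_iterate_eq_zero_iff (k : ℕ) {a : D} : φ^[k] a = 0 ↔ a = 0 :=
  ⟨fun h => (RingHom.injective (φ : D →+* D)).iterate _ (h.trans (iterate_map_zero φ _).symm),
    fun h => by rw [h, iterate_map_zero]⟩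

lemma coeff_mul_natDegree_add_ne_zero {f g : SkewPolynomial D} (hf : f ≠ 0) (hg : g ≠ 0) :
    (f * g).coeff (f.natDegree + g.natDegree) ≠ 0 := by
  rw [coeff_mul_natDegree_add]
  exact mul_ne_zero (coeff_natDegree_ne_zero hf)
    (mt (φ_iterate_eq_zero_iff _).1 (coeff_natDegree_ne_zero hg))

instance : NoZeroDivisors (SkewPolynomial D) where
  eq_zero_or_eq_zero_of_mul_eq_zero {a b} h := by
    by_contra! hc
    exact coeff_mul_natDegree_add_ne_zero hc.1 hc.2 (by rw [h, coeff_zero])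

instance : Nontrivial (SkewPolynomial D) := instNontrivial

instance : IsDomain (SkewPolynomial D) := NoZeroDivisors.to_isDomain _

lemma degree_mul_lt {f g : SkewPolynomial D} {m k : ℕ} (hf : f.degree < (m + 1 : ℕ))
    (hg : g.degree < (k + 1 : ℕ)) : (f * g).degree < (m + k + 1 : ℕ) := by
  rw [← sum_monomial f, sum_def, Finset.sum_mul]
  refine (degreeLT D (m + k + 1)).sum_mem fun i hi => degree_lt_iff.2 fun j hj => ?_
  have him : i ≤ m := by
    by_contra! h
    exact mem_support_iff.1 hi (degree_lt_iff.1 hf i h)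
  obtain ⟨l, rfl⟩ := Nat.exists_eq_add_of_le (show i ≤ j by omega)
  rw [coeff_monomial_mul, degree_lt_iff.1 hg l (by omega), iterate_map_zero, mul_zero]

lemma natDegree_mul {f g : SkewPolynomial D} (hf : f ≠ 0) (hg : g ≠ 0) :
    (f * g).natDegree = f.natDegree + g.natDegree :=
  natDegree_eq_of_coeff (coeff_mul_natDegree_add_ne_zero hf hg) fun i hi =>
    degree_lt_iff.1 (degree_mul_lt (degree_lt_natDegree_succ f) (degree_lt_natDegree_succ g)) i hi

lemma isUnit_of_natDegree_eq_zero {f : SkewPolynomial D} (hf : f ≠ 0) (h : f.natDegree = 0) :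
    IsUnit f := by
  have h1 := eq_C_of_natDegree_eq_zero h
  have h2 : f.coeff 0 ≠ 0 := fun h0 => hf (by rw [h1, h0, C_0])
  rw [h1]
  exact (IsUnit.mk0 _ h2).map (CRingHom : D →+* SkewPolynomial D)

lemma natDegree_eq_zero_of_isUnit {f : SkewPolynomial D} (h : IsUnit f) : f.natDegree = 0 := by
  obtain ⟨v, rfl⟩ := h
  have h1 := natDegree_mul v.ne_zero v⁻¹.ne_zero
  rw [Units.mul_inv, natDegree_one] at h1
  omega

/-- Right division with remainder makes a nonzero element of least degree generate a left ideal. -/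
instance : IsPrincipalIdealRing (SkewPolynomial D) where
  principal J := by
    by_cases hJ : J = ⊥
    · exact ⟨0, by rw [hJ, Submodule.span_zero_singleton]⟩
    obtain ⟨g0, hg0, hg00⟩ := J.exists_mem_ne_zero_of_ne_bot hJ
    have hex : ∃ N : ℕ, ∃ g ∈ J, g ≠ 0 ∧ g.natDegree = N := ⟨_, g0, hg0, hg00, rfl⟩
    classical
    obtain ⟨g, hgJ, hg, hgN⟩ := Nat.find_spec hex
    refine ⟨g, le_antisymm (fun p hp => ?_) ((Submodule.span_singleton_le_iff_mem _ _).2 hgJ)⟩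
    obtain ⟨r, hr, q, hq⟩ := exists_rem hg p
    have hrJ : r ∈ J := by
      have : r = p - q * g := by rw [hq, add_sub_cancel_left]
      rw [this]
      exact J.sub_mem hp (J.mul_mem_left q hgJ)
    have hr0 : r = 0 := by
      by_contra hr0
      refine Nat.find_min hex (m := r.natDegree) ?_ ⟨r, hrJ, hr0, rfl⟩
      rw [← hgN]
      by_contra! hc
      exact coeff_natDegree_ne_zero hr0 (degree_lt_iff.1 hr _ hc)
    exact Submodule.mem_span_singleton.2 ⟨q, by rw [hq, hr0, add_zero, smul_eq_mul]⟩

lemma exists_list_irreducible_prod {f : SkewPolynomial D} (hf : f ≠ 0) (h : 0 < f.natDegree) :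
    ∃ L : List (SkewPolynomial D), (∀ p ∈ L, Irreducible p) ∧ L.prod = f := by
  induction hN : f.natDegree using Nat.strong_induction_on generalizing f with
  | _ N ih =>
    by_cases hirr : Irreducible f
    · exact ⟨[f], by simpa using hirr, List.prod_singleton⟩
    · have hu : ¬ IsUnit f := fun hu => h.ne' (natDegree_eq_zero_of_isUnit hu)
      rw [irreducible_iff, not_and] at hirr
      have := hirr hu
      push Not at this
      obtain ⟨a, b, rfl, ha, hb⟩ := this
      have ha0 := left_ne_zero_of_mul hf
      have hb0 := right_ne_zero_of_mul hf
      have ha1 : 0 < a.natDegree :=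
        Nat.pos_of_ne_zero fun h0 => ha (isUnit_of_natDegree_eq_zero ha0 h0)
      have hb1 : 0 < b.natDegree :=
        Nat.pos_of_ne_zero fun h0 => hb (isUnit_of_natDegree_eq_zero hb0 h0)
      rw [natDegree_mul ha0 hb0] at hN
      obtain ⟨L, hL, rfl⟩ := ih a.natDegree (by omega) ha0 ha1 rfl
      obtain ⟨L', hL', rfl⟩ := ih b.natDegree (by omega) hb0 hb1 rfl
      refine ⟨L ++ L', fun p hp => ?_, List.prod_append⟩
      rcases List.mem_append.1 hp with h | h
      exacts [hL p h, hL' p h]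

lemma hasFactorCount_of_length_eq {h : SkewPolynomial D} {k : ℕ} (h0 : h ≠ 0)
    (hdeg : 0 < h.natDegree)
    (hk : Module.length (SkewPolynomial D) (SkewPolynomial D ⧸ Ideal.span {h}) = k) :
    HasFactorCount h k := by
  refine ⟨exists_list_irreducible_prod h0 hdeg, fun L hL hprod => ?_⟩
  have := length_quotient_span_prod L hL
  rw [hprod, hk] at this
  exact_mod_cast this.symm

/-! ### Dimensions of quotients by left ideals -/

lemma coeff_sum {ι : Type*} (s : Finset ι) (g : ι → SkewPolynomial D) (j : ℕ) :
    (∑ i ∈ s, g i).coeff j = ∑ i ∈ s, (g i).coeff j :=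
  map_sum (AddMonoidHom.mk' (fun g : SkewPolynomial D => g.coeff j) fun a b => coeff_add a b _) _ _

variable (D) in
/-- The coefficients of a skew polynomial of degree less than `N`. -/
def degreeLTCoeff (N : ℕ) : degreeLT D N →ₗ[D] (Fin N → D) where
  toFun g i := (g : SkewPolynomial D).coeff i
  map_add' a b := funext fun i => coeff_add (a : SkewPolynomial D) b i
  map_smul' c a := funext fun i => coeff_smul c (a : SkewPolynomial D) i

variable (D) in
/-- Skew polynomials of degree less than `N`, as tuples of coefficients. -/
def degreeLTEquiv (N : ℕ) : degreeLT D N ≃ₗ[D] (Fin N → D) := by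
  refine LinearEquiv.ofBijective (degreeLTCoeff D N) ⟨fun a b hab => Subtype.ext <|
    SkewPolynomial.ext fun i => ?_, fun v => ?_⟩
  · by_cases hi : i < N
    · exact congrFun hab ⟨i, hi⟩
    · rw [degree_lt_iff.1 a.2 i (not_lt.1 hi), degree_lt_iff.1 b.2 i (not_lt.1 hi)]
  · have hcoeff : ∀ j : ℕ, (∑ i : Fin N, monomial (i : ℕ) (v i)).coeff j =
        ∑ i : Fin N, if (i : ℕ) = j then v i else 0 := fun j => by
      rw [coeff_sum, Finset.sum_congr rfl fun i _ => coeff_monomial]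
    refine ⟨⟨∑ i : Fin N, monomial (i : ℕ) (v i), degree_lt_iff.2 fun j hj => ?_⟩,
      funext fun j => ?_⟩
    · rw [hcoeff]
      exact Finset.sum_eq_zero fun i _ => if_neg (by omega)
    · change (∑ i : Fin N, monomial (i : ℕ) (v i)).coeff j = v j
      rw [hcoeff, Finset.sum_eq_single j (fun i _ hij => if_neg (mt Fin.ext hij))
        (fun h => absurd (Finset.mem_univ j) h), if_pos rfl]

/-- The remainders represent the cosets of `R f`. -/
def degreeLTEquivQuotient {f : SkewPolynomial D} (hf : f ≠ 0) :
    degreeLT D f.natDegree ≃ₗ[D] SkewPolynomial D ⧸ Ideal.span {f} :=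
  LinearEquiv.ofBijective
    { toFun := fun g => Submodule.Quotient.mk g.1
      map_add' := fun _ _ => rfl
      map_smul' := fun _ _ => rfl }
    ⟨fun a b hab => by
        obtain ⟨q, hq⟩ := Ideal.mem_span_singleton'.1 ((Submodule.Quotient.eq _).1 hab)
        have h0 : q = 0 := eq_zero_of_degree_mul_lt hf (by
          rw [hq]; exact (degreeLT D f.natDegree).sub_mem a.2 b.2)
        rw [h0, zero_mul] at hq
        exact Subtype.ext (sub_eq_zero.1 hq.symm),
      fun x => by
        obtain ⟨x, rfl⟩ := Submodule.mkQ_surjective _ x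
        obtain ⟨q, hq⟩ := exists_eq_mul_add_rightRem hf x
        refine ⟨⟨rightRem f x, degree_rightRem_lt f x⟩, (Submodule.Quotient.eq _).2 ?_⟩
        refine Ideal.mem_span_singleton'.2 ⟨-q, ?_⟩
        rw [neg_mul, neg_eq_iff_eq_neg, neg_sub]
        exact eq_sub_of_add_eq hq.symm⟩

lemma finite_quotient {f : SkewPolynomial D} (hf : f ≠ 0) :
    Module.Finite D (SkewPolynomial D ⧸ Ideal.span {f}) :=
  Module.Finite.equiv ((degreeLTEquiv D _).symm.trans (degreeLTEquivQuotient hf))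

lemma finrank_quotient {f : SkewPolynomial D} (hf : f ≠ 0) :
    Module.finrank D (SkewPolynomial D ⧸ Ideal.span {f}) = f.natDegree := by
  rw [← ((degreeLTEquiv D _).symm.trans (degreeLTEquivQuotient hf)).finrank_eq,
    Module.finrank_fin_fun]

end basic

end SkewPolynomial

namespace SkewPolynomial

/-! ### The right nucleus of a Petit algebra as an endomorphism ring -/

section nucleus

open MulOpposite

variable {D : Type*} [DivisionRing D] [MulSemiringAction (Multiplicative ℕ) D]

lemma ne_zero_of_lt_natDegree {f : SkewPolynomial D} {i : ℕ} (hf : i < f.natDegree) : f ≠ 0 := by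
  rintro rfl
  exact absurd hf (Nat.not_lt_zero i)

lemma mk_mul_rightRem {f : SkewPolynomial D} (hf : f ≠ 0) (r g : SkewPolynomial D) :
    (Submodule.Quotient.mk (r * rightRem f g) : SkewPolynomial D ⧸ Ideal.span {f}) =
      Submodule.Quotient.mk (r * g) := by
  obtain ⟨q, hq⟩ := exists_eq_mul_add_rightRem hf g
  refine (Submodule.Quotient.eq _).2 (Ideal.mem_span_singleton'.2 ⟨-(r * q), ?_⟩)
  rw [neg_mul, neg_eq_iff_eq_neg, neg_sub, mul_assoc, ← mul_sub]
  exact congrArg _ (eq_sub_of_add_eq hq.symm)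

lemma mk_rightRem {f : SkewPolynomial D} (hf : f ≠ 0) (g : SkewPolynomial D) :
    (Submodule.Quotient.mk (rightRem f g) : SkewPolynomial D ⧸ Ideal.span {f}) =
      Submodule.Quotient.mk g := by
  simpa only [one_mul] using mk_mul_rightRem hf 1 g

lemma rightRem_eq_rightRem_iff {f : SkewPolynomial D} (hf : f ≠ 0) {a b : SkewPolynomial D} :
    rightRem f a = rightRem f b ↔ a - b ∈ Ideal.span {f} := by
  rw [← Submodule.Quotient.eq (Ideal.span {f} : Ideal (SkewPolynomial D))]
  constructor
  · intro h
    rw [← mk_rightRem hf a, h, mk_rightRem hf]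
  · intro h
    obtain ⟨q, hq⟩ := exists_eq_mul_add_rightRem hf b
    obtain ⟨c, hc⟩ := Ideal.mem_span_singleton'.1 ((Submodule.Quotient.eq _).1 h)
    refine rightRem_eq hf (degree_rightRem_lt f b) (q := c + q) ?_
    rw [add_mul, hc, add_assoc, ← hq, sub_add_cancel]

lemma toPoly_coe_mul {f : SkewPolynomial D} (x y : rightNucleus (PetitAlgebra f)) :
    ((x * y : rightNucleus (PetitAlgebra f)) : PetitAlgebra f).toPoly =
      rightRem f ((x : PetitAlgebra f).toPoly * (y : PetitAlgebra f).toPoly) := rfl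

/-- If `ab = qf + r` with `r` the remainder, then `a(bx) - (ab)x` is congruent to `qfx` modulo `Rf`.
So `fx ∈ Rf` suffices, and it is necessary once some pair `a, b` has an invertible quotient `q`. -/
lemma mem_rightNucleus_iff {f : SkewPolynomial D} (hf : 1 < f.natDegree) {x : PetitAlgebra f} :
    x ∈ rightNucleus (PetitAlgebra f) ↔ f * x.toPoly ∈ Ideal.span {f} := by
  have hf0 : f ≠ 0 := ne_zero_of_lt_natDegree hf
  have key : ∀ a b : PetitAlgebra f, ∀ q, a.toPoly * b.toPoly =
      q * f + rightRem f (a.toPoly * b.toPoly) →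
      (a * b * x = a * (b * x) ↔ q * (f * x.toPoly) ∈ Ideal.span {f}) := fun a b q hq => by
    rw [← PetitAlgebra.toPoly_injective.eq_iff, PetitAlgebra.toPoly_mul, PetitAlgebra.toPoly_mul,
      PetitAlgebra.toPoly_mul, PetitAlgebra.toPoly_mul, eq_comm, rightRem_eq_rightRem_iff hf0,
      ← Submodule.Quotient.mk_eq_zero (Ideal.span {f} : Ideal (SkewPolynomial D)),
      Submodule.Quotient.mk_sub, mk_mul_rightRem hf0, ← Submodule.Quotient.mk_sub,
      Submodule.Quotient.mk_eq_zero, ← mul_assoc, ← mul_assoc, ← sub_mul]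
    rw [eq_sub_of_add_eq hq.symm]
  constructor
  · intro hx
    have hX : ∀ i : ℕ, i < f.natDegree → (X ^ i : SkewPolynomial D).degree < f.natDegree :=
      fun i hi => degree_lt_iff.2 fun j hj => by
        rw [← monomial_one_right_eq_X_pow, coeff_monomial, if_neg (by omega)]
    -- The product `t^(m-1) · t = t^m` has degree exactly `m`, so its quotient by `f` is a nonzero
    -- constant. Degree `m > 1` is needed for `t` itself to lie in `S_f`.
    let a : PetitAlgebra f := ⟨X ^ (f.natDegree - 1), hX _ (by omega)⟩
    let b : PetitAlgebra f := ⟨X ^ 1, hX _ hf⟩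
    have hab : a.toPoly * b.toPoly = X ^ f.natDegree := by
      change X ^ (f.natDegree - 1) * X ^ 1 = _
      rw [← pow_add, Nat.sub_add_cancel (by omega)]
    obtain ⟨q, hq⟩ := exists_eq_mul_add_rightRem hf0 (a.toPoly * b.toPoly)
    have h1 := (key a b q hq).1 (hx a b)
    have hqf : (q * f).natDegree = f.natDegree := by
      have h2 : q * f = X ^ f.natDegree - rightRem f (X ^ f.natDegree) := by
        rw [← hab]; exact eq_sub_of_add_eq hq.symm
      have h3 := degree_rightRem_lt f (X ^ f.natDegree)
      rw [degree_lt_iff] at h3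
      rw [h2]
      refine natDegree_eq_of_coeff ?_ fun i hi => ?_
      · rw [coeff_sub, h3 _ le_rfl, ← monomial_one_right_eq_X_pow, coeff_monomial, if_pos rfl,
          sub_zero]
        exact one_ne_zero
      · rw [coeff_sub, h3 _ hi.le, ← monomial_one_right_eq_X_pow, coeff_monomial,
          if_neg hi.ne, sub_zero]
    have hq0 : q ≠ 0 := fun h0 => by
      rw [h0, zero_mul] at hqf
      exact ne_zero_of_lt_natDegree (hqf ▸ hf) rfl
    rw [natDegree_mul hq0 hf0] at hqf
    obtain ⟨v, rfl⟩ := isUnit_of_natDegree_eq_zero hq0 (by omega)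
    have h4 := Ideal.mul_mem_left _ ((v⁻¹ : (SkewPolynomial D)ˣ) : SkewPolynomial D) h1
    rwa [Units.inv_mul_cancel_left] at h4
  · intro hx a b
    obtain ⟨q, hq⟩ := exists_eq_mul_add_rightRem hf0 (a.toPoly * b.toPoly)
    exact (key a b q hq).2 (Ideal.mul_mem_left _ q hx)

/-- The right nucleus of `S_f` acts on `R / R f` by right multiplication. -/
def nucleusHom {f : SkewPolynomial D} (hf : 1 < f.natDegree) :
    rightNucleus (PetitAlgebra f) →+*
      (Module.End (SkewPolynomial D) (SkewPolynomial D ⧸ Ideal.span {f}))ᵐᵒᵖ :=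
  { (AddMonoidHom.mk' (fun x : rightNucleus (PetitAlgebra f) =>
      op (mulRightQuotient (x : PetitAlgebra f).toPoly ((mem_rightNucleus_iff hf).1 x.prop)))
      fun x y => unop_injective <| LinearMap.ext fun r => by
        obtain ⟨r, rfl⟩ := Submodule.mkQ_surjective _ r
        exact congrArg Submodule.Quotient.mk (mul_add r _ _)) with
    map_one' := unop_injective <| LinearMap.ext fun r => by
      obtain ⟨r, rfl⟩ := Submodule.mkQ_surjective _ r
      change (Submodule.Quotient.mk (r * rightRem f 1) : SkewPolynomial D ⧸ Ideal.span {f}) =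
        Submodule.Quotient.mk r
      rw [mk_mul_rightRem (ne_zero_of_lt_natDegree hf), mul_one]
    map_mul' := fun x y => unop_injective <| LinearMap.ext fun r => by
      obtain ⟨r, rfl⟩ := Submodule.mkQ_surjective _ r
      change (Submodule.Quotient.mk (r * _) : SkewPolynomial D ⧸ Ideal.span {f}) =
        Submodule.Quotient.mk (r * _ * _)
      rw [toPoly_coe_mul, mk_mul_rightRem (ne_zero_of_lt_natDegree hf), mul_assoc] }

/-- The right nucleus of `S_f` is the opposite of the endomorphism ring of `R / R f`. -/
def nucleusEquiv {f : SkewPolynomial D} (hf : 1 < f.natDegree) :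
    rightNucleus (PetitAlgebra f) ≃+*
      (Module.End (SkewPolynomial D) (SkewPolynomial D ⧸ Ideal.span {f}))ᵐᵒᵖ := by
  have hf0 : f ≠ 0 := ne_zero_of_lt_natDegree hf
  refine RingEquiv.ofBijective (nucleusHom hf) ⟨fun x y hxy => ?_, fun φ => ?_⟩
  · have h := LinearMap.congr_fun (congrArg unop hxy) (Submodule.Quotient.mk 1)
    change (Submodule.Quotient.mk (1 * _) : SkewPolynomial D ⧸ Ideal.span {f}) =
      Submodule.Quotient.mk (1 * _) at h
    rw [one_mul, one_mul, Submodule.Quotient.eq, ← rightRem_eq_rightRem_iff hf0,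
      PetitAlgebra.rightRem_toPoly, PetitAlgebra.rightRem_toPoly] at h
    exact Subtype.ext (PetitAlgebra.toPoly_injective h)
  · obtain ⟨g, hg⟩ := Submodule.mkQ_surjective _ (unop φ (Submodule.Quotient.mk 1))
    have hmk : ∀ r : SkewPolynomial D, unop φ (Submodule.Quotient.mk r) =
        Submodule.Quotient.mk (r * rightRem f g) := fun r => by
      have h1 : (Submodule.Quotient.mk r : SkewPolynomial D ⧸ Ideal.span {f}) =
        r • Submodule.Quotient.mk 1 := congrArg Submodule.Quotient.mk (mul_one r).symm
      rw [h1, map_smul, ← hg, mk_mul_rightRem hf0]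
      rfl
    have hmem : PetitAlgebra.mk f g ∈ rightNucleus (PetitAlgebra f) := by
      refine (mem_rightNucleus_iff hf).2 ?_
      change f * rightRem f g ∈ _
      rw [← Submodule.Quotient.mk_eq_zero, ← hmk,
        (Submodule.Quotient.mk_eq_zero _).2 (Ideal.mem_span_singleton_self f), map_zero]
    refine ⟨⟨PetitAlgebra.mk f g, hmem⟩, unop_injective <| LinearMap.ext fun r => ?_⟩
    obtain ⟨r, rfl⟩ := Submodule.mkQ_surjective _ r
    exact (hmk r).symm

lemma nucleusEquiv_apply_mk {f : SkewPolynomial D} (hf : 1 < f.natDegree)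
    (x : rightNucleus (PetitAlgebra f)) (r : SkewPolynomial D) :
    unop (nucleusEquiv hf x) (Submodule.Quotient.mk r) =
      Submodule.Quotient.mk (r * (x : PetitAlgebra f).toPoly) := rfl

/-- Schur's lemma for the simple module `R/Rf`. -/
lemma isUnit_of_ne_zero_of_mem_nucleus {f : SkewPolynomial D} (hf : 1 < f.natDegree)
    (hirr : Irreducible f) {x : rightNucleus (PetitAlgebra f)} (hx : x ≠ 0) : IsUnit x := by
  have := isSimpleModule_quotient_of_irreducible hirr
  have h0 : unop (nucleusEquiv hf x) ≠ 0 := fun h => hx <|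
    (map_eq_zero_iff (nucleusEquiv hf) (nucleusEquiv hf).injective).1 (unop_injective h)
  have h1 : IsUnit (unop (nucleusEquiv hf x)) :=
    (Module.End.isUnit_iff _).2 (LinearMap.bijective_of_ne_zero h0)
  have h2 : IsUnit (nucleusEquiv hf x) := h1.op
  exact (MulEquiv.isUnit_map (nucleusEquiv hf)).1 h2

lemma mk_mem_rightNucleus_of_commute {f : SkewPolynomial D} (hf : 1 < f.natDegree)
    {c : SkewPolynomial D} (hc : ∀ r, c * r = r * c) :
    PetitAlgebra.mk f c ∈ rightNucleus (PetitAlgebra f) := by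
  have hf0 : f ≠ 0 := ne_zero_of_lt_natDegree hf
  refine (mem_rightNucleus_iff hf).2 ?_
  change f * rightRem f c ∈ _
  rw [← Submodule.Quotient.mk_eq_zero, mk_mul_rightRem hf0, Submodule.Quotient.mk_eq_zero, ← hc]
  exact Ideal.mem_span_singleton'.2 ⟨c, rfl⟩

lemma nucleusEquiv_mk_of_commute {f : SkewPolynomial D} (hf : 1 < f.natDegree)
    {c : SkewPolynomial D} (hc : ∀ r, c * r = r * c)
    (v : SkewPolynomial D ⧸ Ideal.span {f}) :
    unop (nucleusEquiv hf ⟨PetitAlgebra.mk f c, mk_mem_rightNucleus_of_commute hf hc⟩) v =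
      c • v := by
  have hf0 : f ≠ 0 := ne_zero_of_lt_natDegree hf
  obtain ⟨v, rfl⟩ := Submodule.mkQ_surjective _ v
  rw [Submodule.mkQ_apply, nucleusEquiv_apply_mk]
  exact (mk_mul_rightRem hf0 v c).trans (congrArg Submodule.Quotient.mk (hc v).symm)

end nucleus

end SkewPolynomial

/-! ### The dimension of a division ring over the fixed field of an automorphism -/

section innerOrder

variable {D : Type*} [DivisionRing D]

/-- A nonzero `a` intertwining `σ^i` and `σ^j` would make `σ^|i-j|` inner, with `|i-j| < n`. -/
lemma HasInnerOrder.eq_of_conj {σ : D ≃+* D} {n : ℕ} (hn : HasInnerOrder σ n) {i j : ℕ}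
    (hi : i < n) (hj : j < n) {a : D} (ha : a ≠ 0)
    (h : ∀ y : D, a * σ^[i] y = σ^[j] y * a) : i = j := by
  have hsurj : ∀ k : ℕ, Function.Surjective σ^[k] := fun k => σ.surjective.iterate k
  rcases lt_trichotomy i j with hij | hij | hij
  · refine absurd ⟨Units.mk0 a ha, fun w => ?_⟩ (hn.2.2 (j - i) (by omega) (by omega))
    obtain ⟨y, rfl⟩ := hsurj i w
    rw [← Function.iterate_add_apply, Nat.sub_add_cancel hij.le]
    exact (Units.eq_mul_inv_iff_mul_eq (Units.mk0 a ha)).2 (h y).symm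
  · exact hij
  · refine absurd ⟨(Units.mk0 a ha)⁻¹, fun w => ?_⟩ (hn.2.2 (i - j) (by omega) (by omega))
    obtain ⟨y, rfl⟩ := hsurj j w
    rw [← Function.iterate_add_apply, Nat.sub_add_cancel hij.le, inv_inv, mul_assoc]
    exact (Units.eq_inv_mul_iff_mul_eq (Units.mk0 a ha)).2 (h y)

/-- The maps `x ↦ σ ^ i (x) b_j` are linearly independent over `D`, if `i` is less than the inner
order of `σ` and the `b_j` are linearly independent over the center. -/
lemma HasInnerOrder.eq_zero_of_sum_eq_zero {σ : D ≃+* D} {n : ℕ} (hn : HasInnerOrder σ n)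
    {J : Type*} [Fintype J] {b : J → D} (hb : LinearIndependent (Subring.center D) b)
    (a : Fin n × J → D) (ha : ∀ x : D, ∑ p, a p * (σ^[(p.1 : ℕ)] x * b p.2) = 0) : a = 0 := by
  classical
  induction hN : (Finset.univ.filter fun p => a p ≠ 0).card using Nat.strong_induction_on
    generalizing a with
  | _ N ih =>
    by_contra hne
    obtain ⟨p₀, hp₀⟩ := Function.ne_iff.1 hne
    -- As in Artin's proof of independence of characters, the induction is on the number of nonzero
    -- coefficients; one of them is normalized to `1`.
    set c : Fin n × J → D := fun p => (a p₀)⁻¹ * a p with hc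
    have hc₀ : c p₀ = 1 := inv_mul_cancel₀ hp₀
    have hrel : ∀ x : D, ∑ p, c p * (σ^[(p.1 : ℕ)] x * b p.2) = 0 := fun x => by
      simp only [hc, mul_assoc]
      rw [← Finset.mul_sum]
      simp only [ha, mul_zero]
    -- Evaluating the relation at `yx` and subtracting `σ^{i₀}(y)` times the relation at `x` kills
    -- the coefficient at `p₀`. The shorter relation is trivial by induction, so every `c p`
    -- intertwines two powers of `σ`.
    have hcomm : ∀ (y : D) (p), c p * σ^[(p.1 : ℕ)] y = σ^[(p₀.1 : ℕ)] y * c p := fun y => by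
      have h := ih _ ?_ (fun p => c p * σ^[(p.1 : ℕ)] y - σ^[(p₀.1 : ℕ)] y * c p)
        (fun x => ?_) rfl
      · exact fun p => sub_eq_zero.1 (congrFun h p)
      · rw [← hN]
        refine Finset.card_lt_card ⟨fun p hp => ?_, fun h => ?_⟩
        · simp only [Finset.mem_filter, Finset.mem_univ, true_and] at hp ⊢
          intro h
          exact hp (by simp [hc, h])
        · have := h (Finset.mem_filter.2 ⟨Finset.mem_univ p₀, hp₀⟩)
          simp [hc₀] at this
      · have h1 : ∀ p : Fin n × J, (c p * σ^[(p.1 : ℕ)] y - σ^[(p₀.1 : ℕ)] y * c p) *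
            (σ^[(p.1 : ℕ)] x * b p.2) = c p * (σ^[(p.1 : ℕ)] (y * x) * b p.2) -
              σ^[(p₀.1 : ℕ)] y * (c p * (σ^[(p.1 : ℕ)] x * b p.2)) := fun p => by
          rw [iterate_map_mul]
          noncomm_ring
        rw [Finset.sum_congr rfl fun p _ => h1 p, Finset.sum_sub_distrib, hrel, ← Finset.mul_sum,
          hrel, mul_zero, sub_zero]
    have hfst : ∀ p, c p ≠ 0 → p.1 = p₀.1 := fun p hp =>
      Fin.ext (hn.eq_of_conj p.1.2 p₀.1.2 hp fun y => hcomm y p)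
    have hcen : ∀ j, c (p₀.1, j) ∈ Subring.center D := fun j =>
      Subring.mem_center_iff.2 fun w => by
        obtain ⟨y, rfl⟩ := σ.surjective.iterate (p₀.1 : ℕ) w
        exact (hcomm y (p₀.1, j)).symm
    -- Only the index `i = p₀.1` survives, with central coefficients, so at `x = 1` the relation
    -- contradicts independence of the `b_j` over the center.
    have h1 := hrel 1
    rw [Fintype.sum_prod_type, Finset.sum_eq_single p₀.1] at h1
    · have h2 := Fintype.linearIndependent_iff.1 hb (fun j => ⟨c (p₀.1, j), hcen j⟩) (by
        rw [← h1]
        exact Finset.sum_congr rfl fun j _ => by rw [iterate_map_one, one_mul]; rfl) p₀.2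
      have h3 : c p₀ = 0 := congrArg Subtype.val h2
      rw [hc₀] at h3
      exact one_ne_zero h3
    · intro i _ hi
      exact Finset.sum_eq_zero fun j _ => by
        by_contra h
        exact hi (hfst (i, j) fun h0 => h (by rw [h0, zero_mul]))
    · exact fun h => absurd (Finset.mem_univ _) h

end innerOrder

namespace SkewPolynomial

section fixedCenter

variable {D : Type*} [DivisionRing D] [MulSemiringAction (Multiplicative ℕ) D]

instance : Algebra (FixedCenter D) (Subring.center D) :=
  inferInstanceAs (Algebra (fixedCenter D) (Subring.center D))

instance : IsScalarTower (FixedCenter D) (Subring.center D) D :=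
  inferInstanceAs (IsScalarTower (fixedCenter D) (Subring.center D) D)

/-- Inner automorphisms fix the center, so the restriction `τ` of `σ` to it satisfies `τⁿ = 1`.
Since `F` is the fixed field of the finite group generated by `τ`, Artin's bound applies. -/
lemma finite_and_finrank_center_le {σ : D ≃+* D} (hσ : ∀ a : D, φ a = σ a) {n : ℕ} (hn : 0 < n)
    {u : Dˣ} (hu : ∀ a : D, σ^[n] a = u * a * (u⁻¹ : Dˣ)) :
    Module.Finite (FixedCenter D) (Subring.center D) ∧
      Module.finrank (FixedCenter D) (Subring.center D) ≤ n := by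
  let τ : RingAut (Subring.center D) := Subring.centerCongr σ
  have hτ : ∀ c : Subring.center D, ((τ c : Subring.center D) : D) = σ c := fun _ => rfl
  have hτk : ∀ (k : ℕ) (c : Subring.center D), (((τ ^ k) c : Subring.center D) : D) = σ^[k] c := by
    intro k
    induction k with
    | zero => exact fun c => rfl
    | succ k ih => intro c; rw [pow_succ, RingAut.mul_apply, ih, hτ]; rfl
  have hτn : τ ^ n = 1 := RingEquiv.ext fun c => Subtype.ext <| by
    rw [hτk, hu, (Subring.mem_center_iff.1 c.2 u), mul_assoc, Units.mul_inv, mul_one]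
    rfl
  have hfin : IsOfFinOrder τ := isOfFinOrder_iff_pow_eq_one.2 ⟨n, hn, hτn⟩
  have : Finite (Subgroup.zpowers τ) := Set.finite_coe_iff.2 (finite_zpowers.2 hfin)
  have := Fintype.ofFinite (Subgroup.zpowers τ)
  have heq : fixedCenter D = FixedPoints.subfield (Subgroup.zpowers τ) (Subring.center D) := by
    ext c
    constructor
    · intro hc g
      have hc1 : τ c = c := Subtype.ext ((hσ (c : D)).symm.trans hc)
      have h2 : g.1 ∈ MulAction.stabilizer (RingAut (Subring.center D)) c :=
        (Subgroup.zpowers_le.2 (MulAction.mem_stabilizer_iff.2 hc1)) g.2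
      exact h2
    · intro hc
      have h1 : τ c = c := hc ⟨τ, Subgroup.mem_zpowers τ⟩
      exact (hσ (c : D)).trans (congrArg Subtype.val h1)
  have hcard : Fintype.card (Subgroup.zpowers τ) ≤ n := by
    rw [← Nat.card_eq_fintype_card, Nat.card_zpowers]
    exact orderOf_le_of_pow_eq_one hn hτn
  have h1 : Module.Finite (fixedCenter D) (Subring.center D) ∧
      Module.finrank (fixedCenter D) (Subring.center D) ≤ n := by
    rw [heq]
    exact ⟨inferInstance, (FixedPoints.finrank_le_card _ _).trans hcard⟩
  exact h1

/-- The tower `F ⊆ C ⊆ D` bounds the dimension above. For the lower bound, the `nd²` maps `x ↦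
σ^i(x) b_j`, recorded by their values on an `F`-basis of `D`, are left `D`-independent vectors in a
space of `D`-dimension `[D:F]`. -/
lemma finite_and_finrank_eq {σ : D ≃+* D} (hσ : ∀ a : D, φ a = σ a) {n : ℕ}
    (hn : HasInnerOrder σ n) {u : Dˣ} (hu : ∀ a : D, σ^[n] a = u * a * (u⁻¹ : Dˣ)) {d : ℕ}
    (hd : 0 < d) (hD : Module.finrank (Subring.center D) D = d ^ 2) :
    Module.Finite (FixedCenter D) D ∧ Module.finrank (FixedCenter D) D = n * d ^ 2 := by
  obtain ⟨hfin, hle⟩ := finite_and_finrank_center_le hσ hn.1 hu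
  have hfinD : Module.Finite (Subring.center D) D :=
    Module.finite_of_finrank_pos (by rw [hD]; positivity)
  have hfinF : Module.Finite (FixedCenter D) D := Module.Finite.trans (Subring.center D) D
  have hmul := Module.finrank_mul_finrank (FixedCenter D) (Subring.center D) D
  rw [hD] at hmul
  refine ⟨hfinF, le_antisymm (hmul ▸ Nat.mul_le_mul_right _ hle) ?_⟩
  let b := Module.finBasis (Subring.center D) D
  let e := Module.finBasis (FixedCenter D) D
  have hsmul : ∀ (i : ℕ) (c : FixedCenter D) (x : D), σ^[i] (c • x) = c • σ^[i] x := by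
    intro i
    induction i with
    | zero => exact fun c x => rfl
    | succ i ih =>
      intro c x
      have hc : σ (algebraMap (FixedCenter D) D c) = algebraMap (FixedCenter D) D c :=
        (hσ _).symm.trans c.2
      rw [Function.iterate_succ_apply, Algebra.smul_def, map_mul, hc, ← Algebra.smul_def, ih]
      rfl
  have hind : LinearIndependent D (fun p : Fin n × Fin (Module.finrank (Subring.center D) D) =>
      fun l => σ^[(p.1 : ℕ)] (e l) * b p.2) := by
    rw [Fintype.linearIndependent_iff]
    intro a ha
    refine congrFun (hn.eq_zero_of_sum_eq_zero b.linearIndependent a fun x => ?_)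
    have hl : ∀ l, ∑ p, a p * (σ^[(p.1 : ℕ)] (e l) * b p.2) = 0 := fun l => by
      have := congrFun ha l
      rwa [Finset.sum_apply] at this
    -- The combination of maps is `F`-linear because `σ` fixes `F`, so vanishing on the basis `e`
    -- forces it to vanish identically.
    let L : D →ₗ[FixedCenter D] D :=
      { toFun := fun x => ∑ p, a p * (σ^[(p.1 : ℕ)] x * b p.2)
        map_add' := fun x y => by
          rw [← Finset.sum_add_distrib]
          exact Finset.sum_congr rfl fun p _ => by rw [iterate_map_add, add_mul, mul_add]
        map_smul' := fun c x => by
          rw [RingHom.id_apply, Finset.smul_sum]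
          exact Finset.sum_congr rfl fun p _ => by
            rw [hsmul, smul_mul_assoc, mul_smul_comm] }
    have hL : L = 0 := e.ext hl
    exact LinearMap.congr_fun hL x
  have := hind.fintype_card_le_finrank
  rwa [Fintype.card_prod, Fintype.card_fin, Fintype.card_fin, Module.finrank_fin_fun, hD] at this

end fixedCenter

end SkewPolynomial

namespace SkewPolynomial

/-! ### Polynomials in the central element `u⁻¹ t ^ n` -/

section central

variable {D : Type*} [DivisionRing D] [MulSemiringAction (Multiplicative ℕ) D] {u : Dˣ} {n : ℕ}

lemma φ_inv_eq (hφu : φ (u : D) = u) : φ ((u⁻¹ : Dˣ) : D) = (u⁻¹ : Dˣ) := by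
  rw [Units.val_inv_eq_inv_val, map_inv₀, hφu]

lemma algebraMap_eq_C (c : FixedCenter D) :
    algebraMap (FixedCenter D) (SkewPolynomial D) c = C (algebraMap (FixedCenter D) D c) := rfl

lemma commute_of_commute_C_X {g : SkewPolynomial D} (hC : ∀ a, g * C a = C a * g)
    (hX : g * X = X * g) (r : SkewPolynomial D) : g * r = r * g := by
  induction r using SkewPolynomial.induction with
  | h0 => rw [mul_zero, zero_mul]
  | ha k a q _ _ ih =>
    have hXk : Commute g (X ^ k) := Commute.pow_right hX k
    rw [mul_add, add_mul, ih, ← C_mul_X_pow_eq_monomial, ← mul_assoc, hC, mul_assoc, hXk.eq,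
      mul_assoc]

/-- Moving `tⁿ` past a constant conjugates it by `u`, which the factor `u⁻¹` undoes; commuting with
`t` is where `σ(u) = u` enters. -/
lemma centralGen_commute (hu : ∀ a : D, φ^[n] a = u * a * (u⁻¹ : Dˣ)) (hφu : φ (u : D) = u)
    (r : SkewPolynomial D) : centralGen u n * r = r * centralGen u n := by
  refine commute_of_commute_C_X (fun a => ?_) ?_ r
  · rw [centralGen, mul_assoc, X_pow_mul_C, hu, ← mul_assoc, ← C_mul, ← mul_assoc, ← mul_assoc,
      Units.inv_mul, one_mul, C_mul, mul_assoc]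
  · rw [centralGen, ← mul_assoc, X_mul_C, φ_inv_eq hφu, mul_assoc, mul_assoc, ← pow_succ,
      ← pow_succ']

lemma aeval_centralGen_commute (hu : ∀ a : D, φ^[n] a = u * a * (u⁻¹ : Dˣ))
    (hφu : φ (u : D) = u) (p : (FixedCenter D)[X]) (r : SkewPolynomial D) :
    Polynomial.aeval (centralGen u n) p * r = r * Polynomial.aeval (centralGen u n) p := by
  induction p using Polynomial.induction_on with
  | C a => rw [Polynomial.aeval_C]; exact Algebra.commutes a r
  | add p q hp hq => rw [map_add, add_mul, mul_add, hp, hq]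
  | monomial k a _ =>
    rw [map_mul, map_pow, Polynomial.aeval_X, Polynomial.aeval_C, mul_assoc,
      (Commute.pow_left (centralGen_commute hu hφu r) (k + 1)).eq, ← mul_assoc,
      Algebra.commutes a r, mul_assoc]

/-- As conjugation by `u`, `σⁿ` fixes powers of `u`, so the constants multiply without a twist. -/
lemma centralGen_pow (hu : ∀ a : D, φ^[n] a = u * a * (u⁻¹ : Dˣ)) (j : ℕ) :
    centralGen u n ^ j = monomial (n * j) (((u⁻¹ ^ j : Dˣ)) : D) := by
  induction j with
  | zero => simp [C_1]
  | succ j ih =>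
    rw [pow_succ', ih, centralGen, C_mul_X_pow_eq_monomial, monomial_mul_monomial, hu, pow_succ,
      Units.val_mul, ← mul_assoc, ← mul_assoc, Units.inv_mul, one_mul, mul_add, mul_one, add_comm]

lemma coeff_aeval_centralGen (hu : ∀ a : D, φ^[n] a = u * a * (u⁻¹ : Dˣ))
    (p : (FixedCenter D)[X]) (i : ℕ) :
    (Polynomial.aeval (centralGen u n) p).coeff i = ∑ j ∈ Finset.range (p.natDegree + 1),
      if n * j = i then algebraMap (FixedCenter D) D (p.coeff j) * ((u⁻¹ ^ j : Dˣ) : D) else 0 := by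
  rw [Polynomial.aeval_eq_sum_range, coeff_sum]
  refine Finset.sum_congr rfl fun j _ => ?_
  rw [centralGen_pow hu, Algebra.smul_def, algebraMap_eq_C, C_mul_monomial, coeff_monomial]

lemma coeff_aeval_centralGen_mul (hn : 0 < n) (hu : ∀ a : D, φ^[n] a = u * a * (u⁻¹ : Dˣ))
    (p : (FixedCenter D)[X]) (j : ℕ) :
    (Polynomial.aeval (centralGen u n) p).coeff (n * j) =
      algebraMap (FixedCenter D) D (p.coeff j) * ((u⁻¹ ^ j : Dˣ) : D) := by
  rw [coeff_aeval_centralGen hu]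
  simp only [Nat.mul_right_inj hn.ne', Finset.sum_ite_eq', Finset.mem_range]
  split_ifs with h
  · rfl
  · rw [Polynomial.coeff_eq_zero_of_natDegree_lt (by omega), map_zero, zero_mul]

lemma natDegree_aeval_centralGen (hn : 0 < n) (hu : ∀ a : D, φ^[n] a = u * a * (u⁻¹ : Dˣ))
    (p : (FixedCenter D)[X]) :
    (Polynomial.aeval (centralGen u n) p).natDegree = n * p.natDegree := by
  by_cases hp : p = 0
  · rw [hp, map_zero, Polynomial.natDegree_zero, mul_zero]; rfl
  refine natDegree_eq_of_coeff ?_ fun i hi => ?_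
  · rw [coeff_aeval_centralGen_mul hn hu]
    refine mul_ne_zero ?_ (Units.ne_zero _)
    rw [_root_.map_ne_zero]
    exact Polynomial.leadingCoeff_ne_zero.2 hp
  · rw [coeff_aeval_centralGen hu]
    refine Finset.sum_eq_zero fun j hj => if_neg fun h => ?_
    have : n * j ≤ n * p.natDegree := Nat.mul_le_mul_left _ (by
      rw [Finset.mem_range] at hj; omega)
    omega

lemma aeval_centralGen_ne_zero (hn : 0 < n) (hu : ∀ a : D, φ^[n] a = u * a * (u⁻¹ : Dˣ))
    {p : (FixedCenter D)[X]} (hp : p ≠ 0) : Polynomial.aeval (centralGen u n) p ≠ 0 := fun h => by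
  have h1 := coeff_aeval_centralGen_mul hn hu p p.natDegree
  rw [h, coeff_zero] at h1
  refine mul_ne_zero ?_ (Units.ne_zero _) h1.symm
  rw [_root_.map_ne_zero]
  exact Polynomial.leadingCoeff_ne_zero.2 hp

/-- Division in `F[x]` gives a remainder whose value at `z` has degree too small to be a nonzero
left multiple of `p(z)`. -/
lemma aeval_centralGen_mem_span_iff (hn : 0 < n) (hu : ∀ a : D, φ^[n] a = u * a * (u⁻¹ : Dˣ))
    {p q : (FixedCenter D)[X]} (hp : p ≠ 0) :
    Polynomial.aeval (centralGen u n) q ∈ Ideal.span {Polynomial.aeval (centralGen u n) p} ↔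
      p ∣ q := by
  constructor
  · intro h
    have hdiv := EuclideanDomain.div_add_mod q p
    have hmod : Polynomial.aeval (centralGen u n) (q % p) ∈
        Ideal.span {Polynomial.aeval (centralGen u n) p} := by
      have h1 : q % p = q - (q / p) * p := by
        rw [eq_sub_iff_add_eq, add_comm, mul_comm]; exact hdiv
      rw [h1, map_sub, map_mul]
      exact Ideal.sub_mem _ h (Ideal.mem_span_singleton'.2 ⟨_, rfl⟩)
    obtain ⟨c, hc⟩ := Ideal.mem_span_singleton'.1 hmod
    rw [← EuclideanDomain.mod_eq_zero]
    by_contra hne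
    have hc0 : c = 0 := eq_zero_of_degree_mul_lt (aeval_centralGen_ne_zero hn hu hp) (by
      rw [hc]
      refine degree_lt_iff.2 fun i hi => coeff_eq_zero_of_natDegree_lt (lt_of_lt_of_le ?_ hi)
      rw [natDegree_aeval_centralGen hn hu, natDegree_aeval_centralGen hn hu]
      exact Nat.mul_lt_mul_of_pos_left
        (Polynomial.natDegree_lt_natDegree hne (EuclideanDomain.mod_lt q hp)) hn)
    rw [hc0, zero_mul] at hc
    exact aeval_centralGen_ne_zero hn hu hne hc.symm
  · rintro ⟨c, rfl⟩
    rw [mul_comm, map_mul]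
    exact Ideal.mem_span_singleton'.2 ⟨_, rfl⟩

lemma iterate_mul_add (hu : ∀ a : D, φ^[n] a = u * a * (u⁻¹ : Dˣ)) (j r : ℕ) (b : D) :
    φ^[n * j + r] b = ((u ^ j : Dˣ) : D) * φ^[r] b * ((u⁻¹ ^ j : Dˣ) : D) := by
  induction j with
  | zero => simp
  | succ j ih =>
    rw [show n * (j + 1) + r = n + (n * j + r) by ring, Function.iterate_add_apply, hu, ih,
      pow_succ', pow_succ, Units.val_mul, Units.val_mul]
    simp only [mul_assoc]

/-- A skew polynomial `g` with `g b = σ ^ e (b) g` for all constants `b`, whose coefficients are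
fixed by `σ`, is essentially a polynomial in `u⁻¹ t ^ n`. -/
lemma exists_eq_aeval_mul_of_twisted {σ : D ≃+* D} (hσ : ∀ a : D, φ a = σ a)
    (hn : HasInnerOrder σ n) (hu : ∀ a : D, φ^[n] a = u * a * (u⁻¹ : Dˣ)) (hφu : φ (u : D) = u)
    {g : SkewPolynomial D} {e : ℕ}
    (hg : ∀ i b, g.coeff i * φ^[i] b = φ^[e] b * g.coeff i) (hfix : ∀ i, φ (g.coeff i) = g.coeff i) :
    ∃ p : (FixedCenter D)[X], g =
      C ((u ^ (e / n) : Dˣ) : D) * Polynomial.aeval (centralGen u n) p * X ^ (e % n) := by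
  have hφσ : (φ : D → D) = σ := funext hσ
  set q := e / n
  set r := e % n
  -- The desired shape is the range of an additive map, so it may be checked on one monomial of `g`
  -- at a time.
  let T : (FixedCenter D)[X] →+ SkewPolynomial D := AddMonoidHom.mk'
    (fun p => C ((u ^ q : Dˣ) : D) * Polynomial.aeval (centralGen u n) p * X ^ r) fun a b => by
      rw [map_add, mul_add, add_mul]
  have hmem : g ∈ T.range := by
    rw [← sum_monomial g, sum_def]
    refine AddSubgroup.sum_mem _ fun i hi => ?_
    have hgi := mem_support_iff.1 hi
    set j := i / n
    -- Removing the powers of `u` reduces both exponents modulo `n`. Then `w` intertwines `σ^(i mod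
    -- n)` and `σ^r`, so the inner order forces `i mod n = r`, and `w` is central and fixed by `σ`.
    set w : D := ((u⁻¹ ^ q : Dˣ) : D) * g.coeff i * ((u ^ j : Dˣ) : D) with hw
    have hw0 : w ≠ 0 := mul_ne_zero (mul_ne_zero (Units.ne_zero _) hgi) (Units.ne_zero _)
    have hwb : ∀ b, w * φ^[i % n] b = φ^[r] b * w := fun b => by
      have h := hg i b
      rw [← Nat.div_add_mod i n, ← Nat.div_add_mod e n, iterate_mul_add hu, iterate_mul_add hu,
        Nat.div_add_mod] at h
      have h2 := congrArg (fun y => ((u⁻¹ ^ q : Dˣ) : D) * y * ((u ^ j : Dˣ) : D)) h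
      have hq1 : ((u⁻¹ ^ q : Dˣ) : D) * ((u ^ q : Dˣ) : D) = 1 := by
        rw [inv_pow, Units.inv_mul]
      have hj1 : ((u⁻¹ ^ j : Dˣ) : D) * ((u ^ j : Dˣ) : D) = 1 := by
        rw [inv_pow, Units.inv_mul]
      calc w * φ^[i % n] b
          = ((u⁻¹ ^ q : Dˣ) : D) * (g.coeff i * (((u ^ j : Dˣ) : D) * φ^[i % n] b *
              ((u⁻¹ ^ j : Dˣ) : D))) * ((u ^ j : Dˣ) : D) := by
            rw [hw]; simp only [mul_assoc]; rw [hj1, mul_one]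
        _ = _ := h2
        _ = (((u⁻¹ ^ q : Dˣ) : D) * ((u ^ q : Dˣ) : D)) * (φ^[r] b * w) := by
            rw [hw]; simp only [mul_assoc]; rfl
        _ = φ^[r] b * w := by rw [hq1, one_mul]
    have hir : i % n = r := hn.eq_of_conj (Nat.mod_lt _ hn.1) (Nat.mod_lt _ hn.1) hw0 fun y => by
      have := hwb y
      rwa [hφσ] at this
    have hwc : w ∈ Subring.center D := Subring.mem_center_iff.2 fun b => by
      obtain ⟨b, rfl⟩ := σ.surjective.iterate r b
      rw [← hφσ, ← hwb, hir]
    have hφpow : ∀ k : ℕ, φ ((u ^ k : Dˣ) : D) = ((u ^ k : Dˣ) : D) := fun k => by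
      rw [Units.val_pow_eq_pow_val, map_pow, hφu]
    have hφpow' : ∀ k : ℕ, φ ((u⁻¹ ^ k : Dˣ) : D) = ((u⁻¹ ^ k : Dˣ) : D) := fun k => by
      rw [Units.val_pow_eq_pow_val, map_pow, φ_inv_eq hφu]
    have hwF : φ w = w := by rw [hw, map_mul, map_mul, hφpow, hφpow', hfix]
    let c : FixedCenter D := ⟨⟨w, hwc⟩, hwF⟩
    refine ⟨Polynomial.monomial j c, ?_⟩
    change C ((u ^ q : Dˣ) : D) * Polynomial.aeval (centralGen u n) (Polynomial.monomial j c) *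
      X ^ r = _
    rw [Polynomial.aeval_monomial, centralGen_pow hu, algebraMap_eq_C, C_mul_monomial,
      C_mul_monomial, monomial_mul_X_pow, ← hir, Nat.div_add_mod]
    congr 1
    change ((u ^ q : Dˣ) : D) * (w * ((u⁻¹ ^ j : Dˣ) : D)) = g.coeff i
    rw [hw, mul_assoc _ _ ((u⁻¹ ^ j : Dˣ) : D), inv_pow, inv_pow, Units.mul_inv, mul_one,
      Units.mul_inv_cancel_left]
  obtain ⟨p, hp⟩ := hmem
  exact ⟨p, hp.symm⟩

lemma exists_eq_C_of_degree_mul_lt {q f : SkewPolynomial D} (hf : f ≠ 0)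
    (h : (q * f).degree < (f.natDegree + 1 : ℕ)) : ∃ c, q = C c := by
  by_cases hq : q = 0
  · exact ⟨0, by rw [hq, C_0]⟩
  · rw [← natDegree_lt_iff (Nat.succ_pos _), natDegree_mul hq hf] at h
    exact ⟨_, eq_C_of_natDegree_eq_zero (by omega)⟩

lemma degree_mul_X_sub_X_mul_lt {g : SkewPolynomial D} {N : ℕ} (hg : g.degree < (N : ℕ)) :
    (g * X - X * g : SkewPolynomial D).degree < (N + 1 : ℕ) := degree_lt_iff.2 fun i hi => by
  obtain ⟨i, rfl⟩ := Nat.exists_eq_add_of_le' (show 1 ≤ i by omega)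
  rw [coeff_sub, coeff_mul_X_succ, coeff_X_mul_succ, degree_lt_iff.1 hg i (by omega), map_zero,
    sub_zero]

/-- Every nonzero two-sided ideal of `D[t;σ]` is generated by the product of a polynomial in the
central element `u⁻¹ t ^ n` and a power of `t`. -/
lemma exists_eq_span_of_isTwoSided {σ : D ≃+* D} (hσ : ∀ a : D, φ a = σ a)
    (hn : HasInnerOrder σ n) (hu : ∀ a : D, φ^[n] a = u * a * (u⁻¹ : Dˣ)) (hφu : φ (u : D) = u)
    {J : Ideal (SkewPolynomial D)} (hJ : J.IsTwoSided) (hJ0 : J ≠ ⊥) :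
    ∃ (p : (FixedCenter D)[X]) (r : ℕ),
      J = Ideal.span {Polynomial.aeval (centralGen u n) p * X ^ r} := by
  obtain ⟨g₀, hg₀⟩ := IsPrincipalIdealRing.principal J
  have hg₀0 : g₀ ≠ 0 := fun h => hJ0 (by rw [hg₀, h, Submodule.span_zero_singleton])
  set e := g₀.natDegree with he
  have hlc := coeff_natDegree_ne_zero hg₀0
  obtain ⟨g, hgdef⟩ : ∃ g, g = C (g₀.coeff e)⁻¹ * g₀ := ⟨_, rfl⟩
  have hspan : ∀ (c : D) (hc : c ≠ 0) (x : SkewPolynomial D),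
      (Ideal.span {C c * x} : Ideal (SkewPolynomial D)) = Ideal.span {x} := fun c hc x => by
    refine le_antisymm ?_ ?_ <;> rw [Ideal.span_singleton_le_iff_mem]
    · exact Ideal.mem_span_singleton'.2 ⟨_, rfl⟩
    · refine Ideal.mem_span_singleton'.2 ⟨C c⁻¹, ?_⟩
      rw [← mul_assoc, ← C_mul, inv_mul_cancel₀ hc, C_1, one_mul]
  have hJg : J = Ideal.span {g} := by rw [hgdef, hspan _ (inv_ne_zero hlc)]; exact hg₀
  have hge : g.coeff e = 1 := by rw [hgdef, coeff_C_mul, inv_mul_cancel₀ hlc]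
  have hgt : ∀ i, e < i → g.coeff i = 0 := fun i hi => by
    rw [hgdef, coeff_C_mul, coeff_eq_zero_of_natDegree_lt hi, mul_zero]
  have hgN : g.natDegree = e := natDegree_eq_of_coeff (by rw [hge]; exact one_ne_zero) hgt
  have hg0 : g ≠ 0 := fun h => one_ne_zero (α := D) (by rw [← hge, h, coeff_zero])
  have hgJ : g ∈ J := by rw [hJg]; exact Ideal.mem_span_singleton_self g
  -- The generator `g` is monic of degree `e`, so `gb - σ^e(b)g` is an element of `J = Rg` of degree
  -- below `e`, hence zero.
  have htw : ∀ i b, g.coeff i * φ^[i] b = φ^[e] b * g.coeff i := fun i b => by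
    have hmem : g * C b - C (φ^[e] b) * g ∈ J :=
      J.sub_mem (J.mul_mem_right _ hgJ) (J.mul_mem_left _ hgJ)
    rw [hJg] at hmem
    obtain ⟨q, hq⟩ := Ideal.mem_span_singleton'.1 hmem
    have hq0 : q = 0 := eq_zero_of_degree_mul_lt hg0 (by
      rw [hq, hgN, degree_lt_iff]
      intro i hi
      rw [coeff_sub, coeff_mul_C, coeff_C_mul]
      rcases hi.eq_or_lt with rfl | hi
      · rw [hge, one_mul, mul_one, sub_self]
      · rw [hgt i hi, zero_mul, mul_zero, sub_zero])
    rw [hq0, zero_mul] at hq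
    have := congrArg (fun x => coeff x i) hq
    simp only [coeff_sub, coeff_mul_C, coeff_C_mul, coeff_zero] at this
    exact sub_eq_zero.1 this.symm
  have hfix : ∀ i, φ (g.coeff i) = g.coeff i := by
    have hmem : g * X - X * g ∈ J := J.sub_mem (J.mul_mem_right _ hgJ) (J.mul_mem_left _ hgJ)
    rw [hJg] at hmem
    obtain ⟨q, hq⟩ := Ideal.mem_span_singleton'.1 hmem
    -- The leading terms of `gt` and `tg` cancel, so `gt - tg` has degree at most `e` and is a
    -- constant multiple `cg`. If `c ≠ 0`, comparing coefficients from the bottom up makes all of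
    -- `g` vanish.
    obtain ⟨c, rfl⟩ : ∃ c, q = C c := exists_eq_C_of_degree_mul_lt hg0 (by
      rw [hq, hgN, degree_lt_iff]
      intro i hi
      obtain ⟨i, rfl⟩ := Nat.exists_eq_add_of_le' (show 1 ≤ i by omega)
      rw [coeff_sub, coeff_mul_X_succ, coeff_X_mul_succ]
      rcases (show e ≤ i by omega).eq_or_lt with rfl | hi
      · rw [hge, map_one, sub_self]
      · rw [hgt i hi, map_zero, sub_zero])
    have hq' : ∀ i, c * g.coeff (i + 1) = g.coeff i - φ (g.coeff i) := fun i => by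
      rw [← coeff_C_mul, hq, coeff_sub, coeff_mul_X_succ, coeff_X_mul_succ]
    have hc : c = 0 := by
      by_contra hc
      have hall : ∀ i, g.coeff i = 0 := by
        intro i
        induction i with
        | zero =>
          have h1 : c * g.coeff 0 = 0 := by
            rw [← coeff_C_mul, hq, coeff_sub, coeff_mul_X_zero, coeff_X_mul_zero, sub_zero]
          exact (mul_eq_zero.1 h1).resolve_left hc
        | succ i ih =>
          have h1 := hq' i
          rw [ih, map_zero, sub_zero] at h1
          exact (mul_eq_zero.1 h1).resolve_left hc
      exact hg0 (SkewPolynomial.ext hall)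
    intro i
    have := hq' i
    rw [hc, zero_mul] at this
    exact (sub_eq_zero.1 this.symm).symm
  obtain ⟨p, hp⟩ := exists_eq_aeval_mul_of_twisted hσ hn hu hφu htw hfix
  exact ⟨p, e % n, by rw [hJg, hp, mul_assoc, hspan _ (Units.ne_zero _)]⟩

lemma coeff_mul_X_pow_zero (g : SkewPolynomial D) {r : ℕ} (hr : 0 < r) :
    (g * X ^ r).coeff 0 = 0 := by
  obtain ⟨r, rfl⟩ := Nat.exists_eq_add_of_le' hr
  rw [pow_succ, ← mul_assoc, coeff_mul_X_zero]

lemma coeff_aeval_centralGen_zero (hn : 0 < n) (hu : ∀ a : D, φ^[n] a = u * a * (u⁻¹ : Dˣ))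
    (p : (FixedCenter D)[X]) :
    (Polynomial.aeval (centralGen u n) p).coeff 0 = algebraMap (FixedCenter D) D (p.coeff 0) := by
  have := coeff_aeval_centralGen_mul hn hu p 0
  rwa [mul_zero, pow_zero, Units.val_one, mul_one] at this

/-- A two-sided ideal above `R p(z)` is `R q(z) t^r`. The nonzero constant coefficient of `p` forces
`r = 0`; then `q ∣ p`, and irreducibility decides. -/
lemma eq_or_eq_top_of_isTwoSided {σ : D ≃+* D} (hσ : ∀ a : D, φ a = σ a)
    (hn : HasInnerOrder σ n) (hu : ∀ a : D, φ^[n] a = u * a * (u⁻¹ : Dˣ)) (hφu : φ (u : D) = u)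
    {p : (FixedCenter D)[X]} (hp : Irreducible p) (hp0 : p.coeff 0 ≠ 0)
    {J : Ideal (SkewPolynomial D)} (hJ : J.IsTwoSided)
    (hle : Ideal.span {Polynomial.aeval (centralGen u n) p} ≤ J) :
    J = Ideal.span {Polynomial.aeval (centralGen u n) p} ∨ J = ⊤ := by
  have hmem := (Ideal.span_singleton_le_iff_mem _).1 hle
  have hJ0 : J ≠ ⊥ := fun h => by
    rw [h, Ideal.mem_bot] at hmem
    exact aeval_centralGen_ne_zero hn.1 hu hp.ne_zero hmem
  obtain ⟨q, r, rfl⟩ := exists_eq_span_of_isTwoSided hσ hn hu hφu hJ hJ0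
  obtain ⟨s, hs⟩ := Ideal.mem_span_singleton'.1 hmem
  have hr : r = 0 := by
    by_contra hr
    have h1 := coeff_aeval_centralGen_zero hn.1 hu p
    rw [← hs, ← mul_assoc, coeff_mul_X_pow_zero _ (Nat.pos_of_ne_zero hr)] at h1
    exact hp0 ((map_eq_zero_iff _ (algebraMap (FixedCenter D) D).injective).1 h1.symm)
  subst hr
  rw [pow_zero, mul_one] at hmem hs ⊢
  have hq0 : q ≠ 0 := fun h => by
    rw [h, map_zero, mul_zero] at hs
    exact aeval_centralGen_ne_zero hn.1 hu hp.ne_zero hs.symm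
  obtain ⟨w, hw⟩ := (aeval_centralGen_mem_span_iff hn.1 hu hq0).1 hmem
  rcases hp.isUnit_or_isUnit hw with hunit | hunit
  · refine Or.inr (Ideal.eq_top_of_isUnit_mem _ (Ideal.mem_span_singleton_self _) ?_)
    exact hunit.map (Polynomial.aeval (centralGen u n))
  · refine Or.inl (le_antisymm ((Ideal.span_singleton_le_iff_mem _).2 ?_)
      ((Ideal.span_singleton_le_iff_mem _).2 hmem))
    rw [aeval_centralGen_mem_span_iff hn.1 hu hp.ne_zero, hw]
    exact (hunit.mul_right_dvd).2 dvd_rfl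

/-- An element of `D[t;σ]` which is central modulo a polynomial `h` in `u⁻¹ t ^ n` with nonzero
constant coefficient is congruent to a polynomial in `u⁻¹ t ^ n`. -/
lemma exists_sub_aeval_mem_of_commute {σ : D ≃+* D} (hσ : ∀ a : D, φ a = σ a)
    (hn : HasInnerOrder σ n) (hu : ∀ a : D, φ^[n] a = u * a * (u⁻¹ : Dˣ)) (hφu : φ (u : D) = u)
    {p : (FixedCenter D)[X]} (hp0 : p.coeff 0 ≠ 0) {a : SkewPolynomial D}
    (ha : ∀ r, a * r - r * a ∈ Ideal.span {Polynomial.aeval (centralGen u n) p}) :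
    ∃ q : (FixedCenter D)[X], a - Polynomial.aeval (centralGen u n) q ∈
      Ideal.span {Polynomial.aeval (centralGen u n) p} := by
  set h := Polynomial.aeval (centralGen u n) p with hh
  have hp : p ≠ 0 := fun h => hp0 (by rw [h, Polynomial.coeff_zero])
  have hh0 : h ≠ 0 := aeval_centralGen_ne_zero hn.1 hu hp
  have hcomm := aeval_centralGen_commute hu hφu p
  obtain ⟨s, hs⟩ := exists_eq_mul_add_rightRem hh0 a
  set g := rightRem h a
  have hag : a - g = s * h := by rw [sub_eq_iff_eq_add]; exact hs
  have hgdeg : g.degree < h.natDegree := degree_rightRem_lt h a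
  have hg : ∀ r, g * r - r * g ∈ Ideal.span {h} := fun r => by
    have h1 : g * r - r * g = (a * r - r * a) - (s * r - r * s) * h := by
      rw [sub_mul, mul_assoc s r h, ← hcomm r, mul_assoc r s h, ← mul_assoc s, ← hag]
      noncomm_ring
    rw [h1]
    exact Ideal.sub_mem _ (ha r) (Ideal.mem_span_singleton'.2 ⟨_, rfl⟩)
  have htw : ∀ i b, g.coeff i * φ^[i] b = φ^[0] b * g.coeff i := fun i b => by
    obtain ⟨q, hq⟩ := Ideal.mem_span_singleton'.1 (hg (C b))
    have hq0 : q = 0 := eq_zero_of_degree_mul_lt hh0 (by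
      rw [hq, degree_lt_iff]
      intro i hi
      rw [coeff_sub, coeff_mul_C, coeff_C_mul, degree_lt_iff.1 hgdeg i hi, zero_mul, mul_zero,
        sub_zero])
    rw [hq0, zero_mul] at hq
    have := congrArg (fun x => coeff x i) hq
    simp only [coeff_sub, coeff_mul_C, coeff_C_mul, coeff_zero] at this
    exact sub_eq_zero.1 this.symm
  have hfix : ∀ i, φ (g.coeff i) = g.coeff i := fun i => by
    obtain ⟨q, hq⟩ := Ideal.mem_span_singleton'.1 (hg X)
    obtain ⟨c, rfl⟩ : ∃ c, q = C c := exists_eq_C_of_degree_mul_lt hh0 (by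
      rw [hq]; exact degree_mul_X_sub_X_mul_lt hgdeg)
    -- The commutator `gt - tg` has zero constant term whereas `h` does not, so `c = 0` and `g`
    -- commutes with `t` exactly, not only modulo `h`.
    have h1 : c * h.coeff 0 = 0 := by
      rw [← coeff_C_mul, hq, coeff_sub, coeff_mul_X_zero, coeff_X_mul_zero, sub_zero]
    have hc : c = 0 := (mul_eq_zero.1 h1).resolve_right (by
      rw [hh, coeff_aeval_centralGen_zero hn.1 hu]
      exact (map_ne_zero_iff _ (algebraMap (FixedCenter D) D).injective).2 hp0)
    rw [hc, C_0, zero_mul] at hq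
    have := congrArg (fun x => coeff x (i + 1)) hq
    simp only [coeff_sub, coeff_mul_X_succ, coeff_X_mul_succ, coeff_zero] at this
    exact (sub_eq_zero.1 this.symm).symm
  obtain ⟨q, hq⟩ := exists_eq_aeval_mul_of_twisted hσ hn hu hφu htw hfix
  rw [Nat.zero_div, Nat.zero_mod, pow_zero, pow_zero, Units.val_one, C_1, one_mul, mul_one] at hq
  exact ⟨q, by rw [← hq, hag]; exact Ideal.mem_span_singleton'.2 ⟨_, rfl⟩⟩

end central

end SkewPolynomial

/-! ### Noncommutative algebras over `K[x]/(p)` -/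

section adjoinRoot

variable {K B : Type*} [Field K] [Ring B] [Algebra K B]

/-- The homomorphism from `K[x]/(p)` to a noncommutative algebra given by a root of `p`. -/
def adjoinRootHom {p : K[X]} {b : B} (hb : Polynomial.aeval b p = 0) : AdjoinRoot p →ₐ[K] B :=
  Ideal.Quotient.liftₐ (Ideal.span {p}) (Polynomial.aeval b) fun a ha => by
    obtain ⟨c, rfl⟩ := Ideal.mem_span_singleton'.1 ha
    rw [map_mul, hb, mul_zero]

/-- The `K[x]/(p)`-algebra structure on a noncommutative algebra given by a central root of `p`. -/
@[reducible]
def adjoinRootAlgebra {p : K[X]} {b : B} (hb : Polynomial.aeval b p = 0)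
    (hc : ∀ x, b * x = x * b) : Algebra (AdjoinRoot p) B :=
  (adjoinRootHom hb).toRingHom.toAlgebra' fun c x => by
    induction c using AdjoinRoot.induction_on with
    | ih q =>
      change Polynomial.aeval b q * x = x * Polynomial.aeval b q
      induction q using Polynomial.induction_on with
      | C a => rw [Polynomial.aeval_C]; exact Algebra.commutes a x
      | add p q hp hq => rw [map_add, add_mul, mul_add, hp, hq]
      | monomial k a _ =>
        have hk : Commute (b ^ (k + 1)) x := Commute.pow_left (hc x) (k + 1)
        rw [map_mul, map_pow, Polynomial.aeval_X, Polynomial.aeval_C, mul_assoc, hk.eq,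
          ← mul_assoc, Algebra.commutes a x, mul_assoc]

/-- A central `x` in `N` gives a central scalar matrix, which comes from `E`; `k > 0` provides an
entry from which `x` is recovered. -/
lemma isCentral_of_algEquiv_matrix {E A N : Type*} [CommRing E] [Ring A] [Ring N] [Algebra E A]
    [Algebra E N] [Algebra.IsCentral E A] {k : ℕ} (hk : 0 < k)
    (e : A ≃ₐ[E] Matrix (Fin k) (Fin k) N) : Algebra.IsCentral E N where
  out x hx := by
    have hx' : ∀ y, y * x = x * y := fun y => Subalgebra.mem_center_iff.1 hx y
    have h1 : e.symm (Matrix.scalar (Fin k) x) ∈ Subalgebra.center E A :=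
      Subalgebra.mem_center_iff.2 fun a => e.injective <| by
        rw [map_mul, map_mul, e.apply_symm_apply]
        exact (Matrix.scalar_commute x (fun y => (hx' y).symm) (e a)).symm.eq
    obtain ⟨c, hc⟩ := Algebra.mem_bot.1 (Algebra.IsCentral.out h1)
    refine Algebra.mem_bot.2 ⟨c, ?_⟩
    have h2 : algebraMap E (Matrix (Fin k) (Fin k) N) c = Matrix.scalar (Fin k) x := by
      rw [← e.commutes, hc, e.apply_symm_apply]
    have h3 := congrFun (congrFun h2 ⟨0, hk⟩) ⟨0, hk⟩
    rwa [Matrix.algebraMap_matrix_apply, if_pos rfl, Matrix.scalar_apply,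
      Matrix.diagonal_apply_eq] at h3

end adjoinRoot

namespace SkewPolynomial

/-! ### The minimal central left multiple -/

section minimal

variable {D : Type*} [DivisionRing D] [MulSemiringAction (Multiplicative ℕ) D] {u : Dˣ} {n : ℕ}
  {f : SkewPolynomial D}

lemma exists_eq_mul_iff_mem_span {g : SkewPolynomial D} :
    (∃ q, g = q * f) ↔ g ∈ Ideal.span {f} := by
  rw [Ideal.mem_span_singleton']
  exact exists_congr fun q => eq_comm

/-- `R/Rf` is finite-dimensional over `F` and `F[x]` is not, so `p ↦ p(z) + Rf` has a kernel. -/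
lemma exists_ne_zero_aeval_mem_span [Module.Finite (FixedCenter D) D] (hf : f ≠ 0) (u : Dˣ)
    (n : ℕ) : ∃ p : (FixedCenter D)[X], p ≠ 0 ∧
      Polynomial.aeval (centralGen u n) p ∈ Ideal.span {f} := by
  have := finite_quotient hf
  have hfin : Module.Finite (FixedCenter D) (SkewPolynomial D ⧸ Ideal.span {f}) :=
    Module.Finite.trans D _
  let L : (FixedCenter D)[X] →ₗ[FixedCenter D] SkewPolynomial D ⧸ Ideal.span {f} :=
    ((Ideal.span {f} : Ideal (SkewPolynomial D)).mkQ.restrictScalars (FixedCenter D)) ∘ₗ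
      (Polynomial.aeval (centralGen u n)).toLinearMap
  by_contra! hc
  refine Polynomial.not_finite (R := FixedCenter D) (Module.Finite.of_injective L ?_)
  rw [← LinearMap.ker_eq_bot, LinearMap.ker_eq_bot']
  intro p hp
  by_contra h0
  exact hc p h0 ((Submodule.Quotient.mk_eq_zero _).1 hp)

/-- The polynomials whose value at `z` lies in `Rf` form an ideal of `F[x]`, generated by its monic
element of least degree. -/
lemma IsMinCentralLeftMultiple.dvd {p q : (FixedCenter D)[X]}
    (hp : IsMinCentralLeftMultiple u n f p)
    (hq : Polynomial.aeval (centralGen u n) q ∈ Ideal.span {f}) : p ∣ q := by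
  rw [← Polynomial.modByMonic_eq_zero_iff_dvd hp.1]
  by_contra hne
  have hmem : Polynomial.aeval (centralGen u n) (q %ₘ p) ∈ Ideal.span {f} := by
    have h1 : q %ₘ p = q - (q /ₘ p) * p := by
      rw [eq_sub_iff_add_eq, mul_comm]; exact Polynomial.modByMonic_add_div q p
    rw [h1, map_sub, map_mul]
    exact Ideal.sub_mem _ hq (Ideal.mul_mem_left _ _ (exists_eq_mul_iff_mem_span.1 hp.2.1))
  have hmon := Polynomial.monic_mul_leadingCoeff_inv hne
  have hle := hp.2.2 _ hmon (exists_eq_mul_iff_mem_span.2 (by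
    rw [mul_comm, map_mul]
    exact Ideal.mul_mem_left _ _ hmem))
  rw [Polynomial.natDegree_mul_leadingCoeff_inv _ hne] at hle
  have hlt := Polynomial.degree_modByMonic_lt q hp.1
  exact absurd (Polynomial.natDegree_lt_natDegree hne hlt) (not_lt.2 hle)

lemma existsUnique_isMinCentralLeftMultiple [Module.Finite (FixedCenter D) D] (hf : f ≠ 0)
    (u : Dˣ) (n : ℕ) : ∃! p : (FixedCenter D)[X], IsMinCentralLeftMultiple u n f p := by
  obtain ⟨p₀, hp₀, hmem₀⟩ := exists_ne_zero_aeval_mem_span hf u n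
  have hex : ∃ N : ℕ, ∃ p : (FixedCenter D)[X], p.natDegree = N ∧ p.Monic ∧
      ∃ g : SkewPolynomial D, Polynomial.aeval (centralGen u n) p = g * f :=
    ⟨_, _, rfl, Polynomial.monic_mul_leadingCoeff_inv hp₀, exists_eq_mul_iff_mem_span.2 (by
      rw [mul_comm, map_mul]
      exact Ideal.mul_mem_left _ _ hmem₀)⟩
  classical
  obtain ⟨p, hpN, hpm, hpf⟩ := Nat.find_spec hex
  have hp : IsMinCentralLeftMultiple u n f p :=
    ⟨hpm, hpf, fun q hq hqf => hpN.trans_le (Nat.find_min' hex ⟨q, rfl, hq, hqf⟩)⟩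
  refine ⟨p, hp, fun q hq => Polynomial.eq_of_monic_of_associated hq.1 hpm
    (associated_of_dvd_dvd (hq.dvd (exists_eq_mul_iff_mem_span.1 hpf))
      (hp.dvd (exists_eq_mul_iff_mem_span.1 hq.2.1)))⟩

/-- If `b ∉ Rf`, then `1 = x + sb` with `x ∈ Rf` by maximality of `Rf`. Multiplying by the central
`a` gives `a = ax + s(ab) ∈ Rf`. Irreducibility of `ĥ` rests on this. -/
lemma mem_span_or_mem_span_of_commute (hf : Irreducible f) {a b : SkewPolynomial D}
    (ha : ∀ r, a * r = r * a) (hab : a * b ∈ Ideal.span {f}) :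
    a ∈ Ideal.span {f} ∨ b ∈ Ideal.span {f} := by
  by_contra! hc
  have hcoatom := isCoatom_span_singleton_of_irreducible hf
  have htop : Ideal.span {f} ⊔ Ideal.span {b} = (⊤ : Ideal (SkewPolynomial D)) :=
    hcoatom.2 _ (lt_of_le_of_ne le_sup_left fun h => hc.2 (by
      rw [h]; exact Ideal.mem_sup_right (Ideal.mem_span_singleton_self b)))
  obtain ⟨x, hx, y, hy, hxy⟩ := Submodule.mem_sup.1 ((Ideal.eq_top_iff_one _).1 htop)
  obtain ⟨s, rfl⟩ := Ideal.mem_span_singleton'.1 hy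
  refine hc.1 ?_
  rw [← mul_one a, ← hxy, mul_add, ← mul_assoc, ha s, mul_assoc]
  exact Ideal.add_mem _ (Ideal.mul_mem_left _ _ hx) (Ideal.mul_mem_left _ _ hab)

lemma one_notMem_span (hf : Irreducible f) : (1 : SkewPolynomial D) ∉ Ideal.span {f} := fun h =>
  (isCoatom_span_singleton_of_irreducible hf).1 ((Ideal.eq_top_iff_one _).2 h)

lemma IsMinCentralLeftMultiple.irreducible (hf : Irreducible f)
    (hu : ∀ a : D, φ^[n] a = u * a * (u⁻¹ : Dˣ)) (hφu : φ (u : D) = u)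
    {p : (FixedCenter D)[X]} (hp : IsMinCentralLeftMultiple u n f p) : Irreducible p := by
  have hmem := exists_eq_mul_iff_mem_span.1 hp.2.1
  have hp0 : p ≠ 0 := hp.1.ne_zero
  have key : ∀ a b : (FixedCenter D)[X], p = a * b →
      Polynomial.aeval (centralGen u n) b ∈ Ideal.span {f} → IsUnit a := fun a b hab hb => by
    obtain ⟨c, hc⟩ := hp.dvd hb
    have hb0 : b ≠ 0 := fun h => hp0 (by rw [hab, h, mul_zero])
    refine IsUnit.of_mul_eq_one c (mul_left_cancel₀ hb0 ?_)
    rw [mul_one]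
    conv_rhs => rw [hc, hab]
    ring
  refine ⟨fun hunit => one_notMem_span hf ?_, fun a b hab => ?_⟩
  · have h1 := hp.1.eq_one_of_isUnit hunit
    rwa [h1, map_one] at hmem
  · have h1 := hmem
    rw [hab, map_mul] at h1
    rcases mem_span_or_mem_span_of_commute hf (aeval_centralGen_commute hu hφu a) h1 with h | h
    · exact Or.inr (key b a (by rw [hab, mul_comm]) h)
    · exact Or.inl (key a b hab h)

lemma X_pow_notMem_span (hf : Irreducible f) (hm : 1 < f.natDegree) (k : ℕ) :
    (X ^ k : SkewPolynomial D) ∉ Ideal.span {f} := by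
  have hcoatom := isCoatom_span_singleton_of_irreducible hf
  have hX : (X : SkewPolynomial D) ∉ Ideal.span {f} := fun h => by
    obtain ⟨q, hq⟩ := Ideal.mem_span_singleton'.1 h
    have hXdeg : (X : SkewPolynomial D).natDegree = 1 := natDegree_eq_of_coeff
      (by rw [coeff_X_one]; exact one_ne_zero) fun i hi => coeff_X_of_ne_one hi.ne'
    have hq0 : q ≠ 0 := fun h => X_ne_zero (by rw [← hq, h, zero_mul])
    rw [← hq, natDegree_mul hq0 hf.ne_zero] at hXdeg
    omega
  have htop : Ideal.span {f} ⊔ Ideal.span {X} = (⊤ : Ideal (SkewPolynomial D)) :=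
    hcoatom.2 _ (lt_of_le_of_ne le_sup_left fun h => hX (by
      rw [h]; exact Ideal.mem_sup_right (Ideal.mem_span_singleton_self X)))
  obtain ⟨x, hx, y, hy, hxy⟩ := Submodule.mem_sup.1 ((Ideal.eq_top_iff_one _).1 htop)
  obtain ⟨s, rfl⟩ := Ideal.mem_span_singleton'.1 hy
  induction k with
  | zero => rw [pow_zero]; exact one_notMem_span hf
  | succ k ih =>
    intro h
    refine ih ?_
    -- With `1 = x + st` and `x ∈ Rf`, moving `t^k` past `s` writes `t^k` as an element of `Rf` plus
    -- a left multiple of `t^(k+1)`, so membership descends to `t^0 = 1`.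
    rw [← mul_one (X ^ k), ← hxy, mul_add, ← mul_assoc, X_pow_mul (p := s), mul_assoc, ← pow_succ]
    exact Ideal.add_mem _ (Ideal.mul_mem_left _ _ hx) (Ideal.mul_mem_left _ _ h)

/-- Otherwise the irreducible monic polynomial is `x` itself, and `tⁿ ∈ Rf`. -/
lemma IsMinCentralLeftMultiple.coeff_zero_ne_zero (hf : Irreducible f) (hm : 1 < f.natDegree)
    {p : (FixedCenter D)[X]} (hp : IsMinCentralLeftMultiple u n f p) (hirr : Irreducible p) :
    p.coeff 0 ≠ 0 := fun h0 => by
  have hdvd : (Polynomial.X : (FixedCenter D)[X]) ∣ p := Polynomial.X_dvd_iff.2 h0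
  have hassoc : Associated (Polynomial.X : (FixedCenter D)[X]) p :=
    Polynomial.irreducible_X.associated_of_dvd hirr hdvd
  have hpX := Polynomial.eq_of_monic_of_associated Polynomial.monic_X hp.1 hassoc
  have hmem := exists_eq_mul_iff_mem_span.1 hp.2.1
  rw [← hpX, Polynomial.aeval_X, centralGen] at hmem
  refine X_pow_notMem_span hf hm n ?_
  have h1 := Ideal.mul_mem_left _ (C (u : D)) hmem
  rwa [← mul_assoc, ← C_mul, Units.mul_inv, C_1, one_mul] at h1

end minimal

/-! ### The action of central elements on the right nucleus -/

section nucleusAlgebra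

open MulOpposite

variable {D : Type*} [DivisionRing D] [MulSemiringAction (Multiplicative ℕ) D]
  {f : SkewPolynomial D}

lemma eq_of_nucleusEquiv_smul (hf : 1 < f.natDegree) {x y : rightNucleus (PetitAlgebra f)}
    (h : ∀ v, unop (nucleusEquiv hf x) v = unop (nucleusEquiv hf y) v) : x = y :=
  (nucleusEquiv hf).injective (unop_injective (LinearMap.ext h))

lemma mul_comm_of_nucleusEquiv_smul (hf : 1 < f.natDegree) {x : rightNucleus (PetitAlgebra f)}
    {c : SkewPolynomial D} (h : ∀ v, unop (nucleusEquiv hf x) v = c • v)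
    (y : rightNucleus (PetitAlgebra f)) : x * y = y * x :=
  eq_of_nucleusEquiv_smul hf fun v => by
    rw [map_mul, map_mul, unop_mul, unop_mul, Module.End.mul_apply, Module.End.mul_apply, h, h,
      map_smul]

lemma nucleusEquiv_algebraMap (hf : 1 < f.natDegree) (c : FixedCenter D)
    (v : SkewPolynomial D ⧸ Ideal.span {f}) :
    unop (nucleusEquiv hf (algebraMap (FixedCenter D) (rightNucleus (PetitAlgebra f)) c)) v =
      algebraMap (FixedCenter D) (SkewPolynomial D) c • v := by
  obtain ⟨v, rfl⟩ := Submodule.mkQ_surjective _ v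
  have h1 : ((algebraMap (FixedCenter D) (rightNucleus (PetitAlgebra f)) c :
      rightNucleus (PetitAlgebra f)) : PetitAlgebra f).toPoly = c • 1 := by
    rw [← PetitAlgebra.toPoly_one (f := f) (by omega), Algebra.algebraMap_eq_smul_one]
    rfl
  rw [Submodule.mkQ_apply, nucleusEquiv_apply_mk, h1, mul_smul_comm, mul_one, Algebra.smul_def]
  rfl

/-- The class of a central element in the right nucleus. -/
def centralNucleus (hf : 1 < f.natDegree) {z : SkewPolynomial D} (hz : ∀ r, z * r = r * z) :
    rightNucleus (PetitAlgebra f) :=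
  ⟨PetitAlgebra.mk f z, mk_mem_rightNucleus_of_commute hf hz⟩

lemma nucleusEquiv_aeval (hf : 1 < f.natDegree) {z : SkewPolynomial D} (hz : ∀ r, z * r = r * z)
    (p : (FixedCenter D)[X]) (v : SkewPolynomial D ⧸ Ideal.span {f}) :
    unop (nucleusEquiv hf (Polynomial.aeval (centralNucleus hf hz) p)) v =
      Polynomial.aeval z p • v := by
  induction p using Polynomial.induction_on generalizing v with
  | C a => rw [Polynomial.aeval_C, Polynomial.aeval_C, nucleusEquiv_algebraMap]
  | add p q hp hq =>
    rw [map_add, map_add, map_add, unop_add, LinearMap.add_apply, hp, hq, add_smul]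
  | monomial k a ih =>
    rw [pow_succ, ← mul_assoc, map_mul _ (_ * _) Polynomial.X, map_mul _ (_ * _) Polynomial.X,
      map_mul (nucleusEquiv hf), unop_mul, Module.End.mul_apply, Polynomial.aeval_X,
      Polynomial.aeval_X, ih, ← hz, mul_smul]
    exact nucleusEquiv_mk_of_commute hf hz _

end nucleusAlgebra

end SkewPolynomial

namespace SkewPolynomial

/-! ### The structure of `R / R h` -/

section structureTheory

open MulOpposite

variable {D : Type*} [DivisionRing D] [MulSemiringAction (Multiplicative ℕ) D]
  {f h : SkewPolynomial D}

lemma isTwoSided_span_singleton_of_commute (hh : ∀ r, h * r = r * h) :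
    (Ideal.span {h} : Ideal (SkewPolynomial D)).IsTwoSided where
  mul_mem_of_left {a} b ha := by
    obtain ⟨c, rfl⟩ := Ideal.mem_span_singleton'.1 ha
    rw [mul_assoc, hh, ← mul_assoc]
    exact Ideal.mem_span_singleton'.2 ⟨_, rfl⟩

/-- Writing `h = qf`, centrality of `h` and cancellation give `fq = qf`, so right multiplication by
`q` maps `R/Rf` to `R/Rh`. It is nonzero because `f` is not a unit. -/
lemma exists_ne_zero_linearMap_quotient (hf : 0 < f.natDegree) (hh0 : h ≠ 0)
    (hh : ∀ r, h * r = r * h) (hmem : h ∈ Ideal.span {f}) :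
    ∃ ψ : (SkewPolynomial D ⧸ Ideal.span {f}) →ₗ[SkewPolynomial D]
      SkewPolynomial D ⧸ Ideal.span {h}, ψ ≠ 0 := by
  obtain ⟨q, rfl⟩ := Ideal.mem_span_singleton'.1 hmem
  have hf0 := ne_zero_of_lt_natDegree hf
  have hq0 := left_ne_zero_of_mul hh0
  have hfq : f * q = q * f := mul_right_cancel₀ hf0 (by rw [mul_assoc, hh f])
  refine ⟨mulRightQuotient q (by rw [hfq]; exact Ideal.mem_span_singleton_self _), fun h0 => ?_⟩
  have h1 := LinearMap.congr_fun h0 (Submodule.Quotient.mk 1)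
  rw [mulRightQuotient_mk, one_mul, LinearMap.zero_apply, Submodule.Quotient.mk_eq_zero] at h1
  obtain ⟨c, hc⟩ := Ideal.mem_span_singleton'.1 h1
  rw [← hfq, ← mul_assoc] at hc
  have h2 : c * f = 1 := mul_right_cancel₀ hq0 (by rw [hc, one_mul])
  have h3 := natDegree_mul (left_ne_zero_of_mul_eq_one h2) hf0
  rw [h2, natDegree_one] at h3
  omega

lemma natDegree_eq_of_linearEquiv (hf0 : f ≠ 0) (hh0 : h ≠ 0) {k : ℕ}
    (e : (SkewPolynomial D ⧸ Ideal.span {h}) ≃ₗ[SkewPolynomial D]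
      (Fin k → SkewPolynomial D ⧸ Ideal.span {f})) : h.natDegree = k * f.natDegree := by
  have := finite_quotient hf0
  have h1 := (e.restrictScalars D).finrank_eq
  rwa [finrank_quotient hh0, Module.finrank_pi_fintype, Finset.sum_const, Finset.card_univ,
    Fintype.card_fin, finrank_quotient hf0, smul_eq_mul] at h1

lemma hasFactorCount_of_linearEquiv (hf : Irreducible f) (hh0 : h ≠ 0) (hdeg : 0 < h.natDegree)
    {k : ℕ} (e : (SkewPolynomial D ⧸ Ideal.span {h}) ≃ₗ[SkewPolynomial D]
      (Fin k → SkewPolynomial D ⧸ Ideal.span {f})) : HasFactorCount h k := by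
  have := isSimpleModule_quotient_of_irreducible hf
  refine hasFactorCount_of_length_eq hh0 hdeg ?_
  rw [e.length_eq, Module.length_pi, Module.length_eq_one, mul_one, ENat.card_eq_coe_fintype_card,
    Fintype.card_fin]

/-- Equal degrees make `h = vf` with `v` a unit, so `f` is a unit times a central element. -/
lemma isRightInvariant_of_natDegree_eq (hf0 : f ≠ 0) (hh0 : h ≠ 0) (hh : ∀ r, h * r = r * h)
    (hmem : h ∈ Ideal.span {f}) (hdeg : h.natDegree = f.natDegree) : f.IsRightInvariant := by
  obtain ⟨q, rfl⟩ := Ideal.mem_span_singleton'.1 hmem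
  have hq0 := left_ne_zero_of_mul hh0
  rw [natDegree_mul hq0 hf0] at hdeg
  obtain ⟨v, rfl⟩ := isUnit_of_natDegree_eq_zero hq0 (by omega)
  refine fun g => ⟨(v⁻¹ : (SkewPolynomial D)ˣ) * g * v, ?_⟩
  have h1 := hh g
  calc f * g = (v⁻¹ : (SkewPolynomial D)ˣ) * (v * f * g) := by
        rw [mul_assoc, Units.inv_mul_cancel_left]
    _ = _ := by rw [h1]; simp only [mul_assoc]

/-- `R / R h` as a matrix ring over the right nucleus of `S_f`. -/
def quotientMatrixNucleusEquiv (hf : 1 < f.natDegree) [(Ideal.span {h}).IsTwoSided] {k : ℕ}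
    (e : (SkewPolynomial D ⧸ Ideal.span {h}) ≃ₗ[SkewPolynomial D]
      (Fin k → SkewPolynomial D ⧸ Ideal.span {f})) :
    (SkewPolynomial D ⧸ Ideal.span {h}) ≃+*
      Matrix (Fin k) (Fin k) (rightNucleus (PetitAlgebra f)) :=
  (quotientMatrixEquiv e).trans (nucleusEquiv hf).symm.mapMatrix

lemma quotientMatrixNucleusEquiv_mk (hf : 1 < f.natDegree) [(Ideal.span {h}).IsTwoSided] {k : ℕ}
    (e : (SkewPolynomial D ⧸ Ideal.span {h}) ≃ₗ[SkewPolynomial D]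
      (Fin k → SkewPolynomial D ⧸ Ideal.span {f})) {c : SkewPolynomial D}
    (hc : ∀ r, c * r = r * c) {x : rightNucleus (PetitAlgebra f)}
    (hx : ∀ v, unop (nucleusEquiv hf x) v = c • v) :
    quotientMatrixNucleusEquiv hf e (Ideal.Quotient.mk _ c) = Matrix.diagonal fun _ => x := by
  rw [quotientMatrixNucleusEquiv, RingEquiv.trans_apply, quotientMatrixEquiv_mk_of_commute e hc hx,
    RingEquiv.mapMatrix_apply, Matrix.diagonal_map (map_zero _)]
  congr 1
  funext i
  exact (nucleusEquiv hf).symm_apply_apply x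

lemma finrank_fixedCenter_quotient (hh0 : h ≠ 0) :
    Module.finrank (FixedCenter D) (SkewPolynomial D ⧸ Ideal.span {h}) =
      Module.finrank (FixedCenter D) D * h.natDegree := by
  rw [← finrank_quotient hh0, Module.finrank_mul_finrank]

end structureTheory

end SkewPolynomial

end

/-! ### The structure theorem -/

open SkewPolynomial in
theorem mainTheorem1 {D : Type*} [DivisionRing D] [MulSemiringAction (Multiplicative ℕ) D]
    (d : ℕ) (hd : 0 < d) (hD : Module.finrank (Subring.center D) D = d ^ 2)
    (σ : D ≃+* D) (hσ : ∀ a : D, SkewPolynomial.φ a = σ a)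
    (n : ℕ) (hn : HasInnerOrder σ n)
    (u : Dˣ) (hu : ∀ a : D, σ^[n] a = u * a * (u⁻¹ : Dˣ)) (hσu : σ (u : D) = u)
    (f : SkewPolynomial D) (hf : Irreducible f)
    (m : ℕ) (hfm : f.natDegree = m) (hm : 1 < m) :
    (∃! hhat : Polynomial (FixedCenter D), IsMinCentralLeftMultiple u n f hhat) ∧
    ∀ (hhat : Polynomial (FixedCenter D)), IsMinCentralLeftMultiple u n f hhat →
    ∀ (h : SkewPolynomial D), h = Polynomial.aeval (centralGen u n) hhat →
      Irreducible hhat ∧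
      ∃ k s : ℕ, HasFactorCount h k ∧ k * s = d * n ∧
        (∃ (_ : Algebra (AdjoinRoot hhat) (rightNucleus (PetitAlgebra f)))
            (_ : IsScalarTower (FixedCenter D) (AdjoinRoot hhat) (rightNucleus (PetitAlgebra f)))
            (_ : (Ideal.span {h}).IsTwoSided)
            (_ : Algebra (AdjoinRoot hhat) (SkewPolynomial D ⧸ Ideal.span {h}))
            (_ : IsScalarTower (FixedCenter D) (AdjoinRoot hhat)
              (SkewPolynomial D ⧸ Ideal.span {h})),
          (algebraMap (AdjoinRoot hhat) (rightNucleus (PetitAlgebra f)) (AdjoinRoot.root hhat) :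
            PetitAlgebra f) = PetitAlgebra.mk f (centralGen u n) ∧
          algebraMap (AdjoinRoot hhat) (SkewPolynomial D ⧸ Ideal.span {h})
            (AdjoinRoot.root hhat) = Ideal.Quotient.mk (Ideal.span {h}) (centralGen u n) ∧
          Nontrivial (rightNucleus (PetitAlgebra f)) ∧
          (∀ x : rightNucleus (PetitAlgebra f), x ≠ 0 → IsUnit x) ∧
          Algebra.IsCentral (AdjoinRoot hhat) (rightNucleus (PetitAlgebra f)) ∧
          Module.finrank (AdjoinRoot hhat) (rightNucleus (PetitAlgebra f)) = s ^ 2 ∧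
          Nonempty ((SkewPolynomial D ⧸ Ideal.span {h}) ≃ₐ[AdjoinRoot hhat]
            Matrix (Fin k) (Fin k) (rightNucleus (PetitAlgebra f)))) ∧
        hhat.natDegree * s = m * d ∧
        h.natDegree * s = m * n * d ∧
        Module.finrank (FixedCenter D) (rightNucleus (PetitAlgebra f)) = m * d * s ∧
        s ∣ Nat.gcd (m * d) (d * n) ∧
        (¬ f.IsRightInvariant → 1 < k ∧ s ≠ d * n) := by
  have hφσ : (SkewPolynomial.φ : D → D) = σ := funext hσ
  have hu' : ∀ a : D, SkewPolynomial.φ^[n] a = u * a * (u⁻¹ : Dˣ) := by rw [hφσ]; exact hu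
  have hφu : SkewPolynomial.φ (u : D) = u := (hσ _).trans hσu
  have hn0 := hn.1
  obtain ⟨hfinF, hDF⟩ := finite_and_finrank_eq hσ hn hu hd hD
  have hf1 : 1 < f.natDegree := hfm ▸ hm
  refine ⟨existsUnique_isMinCentralLeftMultiple hf.ne_zero u n, fun hhat hmin h hh => ?_⟩
  have hirr := hmin.irreducible hf hu' hφu
  have hcoeff := hmin.coeff_zero_ne_zero hf hf1 hirr
  have hz := centralGen_commute hu' hφu
  have hcomm : ∀ r, h * r = r * h := by rw [hh]; exact aeval_centralGen_commute hu' hφu hhat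
  have hh0 : h ≠ 0 := by rw [hh]; exact aeval_centralGen_ne_zero hn0 hu' hirr.ne_zero
  have hmem : h ∈ Ideal.span {f} := by rw [hh]; exact exists_eq_mul_iff_mem_span.1 hmin.2.1
  have hhdeg : h.natDegree = n * hhat.natDegree := by
    rw [hh]; exact natDegree_aeval_centralGen hn0 hu' hhat
  have hapos : 0 < hhat.natDegree := hirr.natDegree_pos
  have htwo : (Ideal.span {h}).IsTwoSided := isTwoSided_span_singleton_of_commute hcomm
  have hsimple := isSimpleModule_quotient_of_irreducible hf
  obtain ⟨ψ, hψ⟩ := exists_ne_zero_linearMap_quotient (by omega) hh0 hcomm hmem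
  obtain ⟨k, ⟨e⟩⟩ := exists_linearEquiv_fun_of_maximal_twoSided (fun J hJ hle => by
    rw [hh] at hle ⊢
    exact eq_or_eq_top_of_isTwoSided hσ hn hu' hφu hirr hcoeff hJ hle) hψ
  have hkm : n * hhat.natDegree = k * m := by
    rw [← hhdeg, ← hfm]; exact natDegree_eq_of_linearEquiv hf.ne_zero hh0 e
  have hk0 : 0 < k := Nat.pos_of_ne_zero fun h0 => by
    rw [h0, zero_mul] at hkm
    exact (Nat.mul_pos hn0 hapos).ne' hkm
  have hζ : Polynomial.aeval (centralNucleus hf1 hz) hhat = 0 :=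
    eq_of_nucleusEquiv_smul hf1 fun v => by
      rw [nucleusEquiv_aeval, ← hh, map_zero]
      obtain ⟨v, rfl⟩ := Submodule.mkQ_surjective _ v
      refine (Submodule.Quotient.mk_eq_zero _).2 ?_
      change h * v ∈ Ideal.span {f}
      rw [hcomm]
      exact Ideal.mul_mem_left _ _ hmem
  have hmk : ∀ p : (FixedCenter D)[X],
      Polynomial.aeval (Ideal.Quotient.mk (Ideal.span {h}) (centralGen u n)) p =
        Ideal.Quotient.mk (Ideal.span {h}) (Polynomial.aeval (centralGen u n) p) := fun p =>
    Polynomial.aeval_algHom_apply (Ideal.Quotient.mkₐ (FixedCenter D) (Ideal.span {h})) _ p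
  have hη : Polynomial.aeval (Ideal.Quotient.mk (Ideal.span {h}) (centralGen u n)) hhat = 0 := by
    rw [hmk, ← hh]
    exact Ideal.Quotient.eq_zero_iff_mem.2 (Ideal.mem_span_singleton_self h)
  let algN : Algebra (AdjoinRoot hhat) (rightNucleus (PetitAlgebra f)) :=
    adjoinRootAlgebra hζ (mul_comm_of_nucleusEquiv_smul hf1 (nucleusEquiv_mk_of_commute hf1 hz))
  let algA : Algebra (AdjoinRoot hhat) (SkewPolynomial D ⧸ Ideal.span {h}) :=
    adjoinRootAlgebra hη fun x => by
      obtain ⟨x, rfl⟩ := Ideal.Quotient.mk_surjective x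
      rw [← map_mul, hz, map_mul]
  have algN_mk : ∀ p, algebraMap (AdjoinRoot hhat) (rightNucleus (PetitAlgebra f))
      (AdjoinRoot.mk hhat p) = Polynomial.aeval (centralNucleus hf1 hz) p := fun p => rfl
  have algA_mk : ∀ p, algebraMap (AdjoinRoot hhat) (SkewPolynomial D ⧸ Ideal.span {h})
      (AdjoinRoot.mk hhat p) = Ideal.Quotient.mk _ (Polynomial.aeval (centralGen u n) p) := hmk
  have towN : IsScalarTower (FixedCenter D) (AdjoinRoot hhat) (rightNucleus (PetitAlgebra f)) :=
    .of_algebraMap_eq fun c => ((adjoinRootHom hζ).commutes c).symm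
  have towA : IsScalarTower (FixedCenter D) (AdjoinRoot hhat)
      (SkewPolynomial D ⧸ Ideal.span {h}) :=
    .of_algebraMap_eq fun c => ((adjoinRootHom hη).commutes c).symm
  let E : (SkewPolynomial D ⧸ Ideal.span {h}) ≃ₐ[AdjoinRoot hhat]
      Matrix (Fin k) (Fin k) (rightNucleus (PetitAlgebra f)) :=
    AlgEquiv.ofRingEquiv (f := quotientMatrixNucleusEquiv hf1 e) fun c => by
      induction c using AdjoinRoot.induction_on with
      | ih p =>
        rw [algA_mk, quotientMatrixNucleusEquiv_mk hf1 e (aeval_centralGen_commute hu' hφu p)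
          (nucleusEquiv_aeval hf1 hz p), ← algN_mk, Matrix.algebraMap_eq_diagonal]
        rfl
  have : Fact (Irreducible hhat) := ⟨hirr⟩
  have hEF : Module.finrank (FixedCenter D) (AdjoinRoot hhat) = hhat.natDegree := by
    rw [(AdjoinRoot.powerBasis hirr.ne_zero).finrank, AdjoinRoot.powerBasis_dim]
  -- Over `F` the dimension is `nd² · n deg ĥ`; dividing by `[E:F] = deg ĥ` leaves `(dn)²`.
  have hAE : Module.finrank (AdjoinRoot hhat) (SkewPolynomial D ⧸ Ideal.span {h}) =
      (d * n) ^ 2 := by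
    have h1 := Module.finrank_mul_finrank (FixedCenter D) (AdjoinRoot hhat)
      (SkewPolynomial D ⧸ Ideal.span {h})
    rw [hEF, finrank_fixedCenter_quotient hh0, hDF, hhdeg] at h1
    refine Nat.eq_of_mul_eq_mul_left hapos (h1.trans ?_)
    ring
  have hkN : (d * n) ^ 2 =
      k ^ 2 * Module.finrank (AdjoinRoot hhat) (rightNucleus (PetitAlgebra f)) := by
    rw [← hAE, E.toLinearEquiv.finrank_eq, Module.finrank_matrix, Fintype.card_fin, sq]
  -- Divisibility of squares descends to the bases, so `s = dn/k` is an integer before the nucleus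
  -- is known to have square dimension.
  obtain ⟨s, hs⟩ : k ∣ d * n := (Nat.pow_dvd_pow_iff two_ne_zero).1 ⟨_, hkN⟩
  have hNs : Module.finrank (AdjoinRoot hhat) (rightNucleus (PetitAlgebra f)) = s ^ 2 := by
    rw [hs, mul_pow] at hkN
    exact (Nat.eq_of_mul_eq_mul_left (by positivity) hkN).symm
  have has : hhat.natDegree * s = m * d := Nat.eq_of_mul_eq_mul_left hn0 <| by
    calc n * (hhat.natDegree * s) = n * hhat.natDegree * s := by ring
      _ = m * (k * s) := by rw [hkm]; ring
      _ = n * (m * d) := by rw [← hs]; ring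
  have hcenA : Algebra.IsCentral (AdjoinRoot hhat) (SkewPolynomial D ⧸ Ideal.span {h}) := ⟨by
    intro x hx
    obtain ⟨x, rfl⟩ := Ideal.Quotient.mk_surjective x
    obtain ⟨q, hq⟩ := exists_sub_aeval_mem_of_commute hσ hn hu' hφu hcoeff (a := x) fun r => by
      rw [← hh, ← Ideal.Quotient.eq_zero_iff_mem, map_sub, map_mul, map_mul, sub_eq_zero]
      exact (Subalgebra.mem_center_iff.1 hx _).symm
    rw [← hh] at hq
    exact Algebra.mem_bot.2 ⟨AdjoinRoot.mk hhat q, by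
      rw [algA_mk]; exact (Ideal.Quotient.eq.2 hq).symm⟩⟩
  refine ⟨hirr, k, s, hasFactorCount_of_linearEquiv hf hh0
    (by rw [hhdeg]; exact Nat.mul_pos hn0 hapos) e, hs.symm,
    ⟨algN, towN, htwo, algA, towA, ?_, ?_, ?_, ?_, ?_, hNs, ⟨E⟩⟩, has, ?_, ?_, ?_, ?_⟩
  · have h1 := algN_mk Polynomial.X
    rw [Polynomial.aeval_X] at h1
    exact congrArg Subtype.val h1
  · have h1 := algA_mk Polynomial.X
    rw [Polynomial.aeval_X] at h1
    exact h1
  · refine ⟨⟨0, 1, fun h01 => one_notMem_span hf ?_⟩⟩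
    have h1 := LinearMap.congr_fun (congrArg (fun x => MulOpposite.unop (nucleusEquiv hf1 x)) h01)
      (Submodule.Quotient.mk 1)
    simp only [map_zero, map_one] at h1
    exact (Submodule.Quotient.mk_eq_zero _).1 h1.symm
  · exact fun x hx => isUnit_of_ne_zero_of_mem_nucleus hf1 hf hx
  · exact isCentral_of_algEquiv_matrix hk0 E
  · rw [hhdeg, mul_assoc, has]; ring
  · rw [← Module.finrank_mul_finrank (FixedCenter D) (AdjoinRoot hhat), hEF, hNs, sq, ← mul_assoc,
      has]
  · exact Nat.dvd_gcd ⟨_, by rw [← has, mul_comm]⟩ ⟨_, by rw [hs, mul_comm]⟩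
  · intro hinv
    have hk1 : 1 < k := by
      -- If `k = 1`, then `deg h = m`, so `f` agrees with the central `h` up to a unit and is
      -- right-invariant.
      by_contra hk1
      have hk : k = 1 := by omega
      refine hinv (isRightInvariant_of_natDegree_eq hf.ne_zero hh0 hcomm hmem ?_)
      rw [hhdeg, hkm, hk, one_mul, hfm]
    refine ⟨hk1, fun hsd => ?_⟩
    have hpos : 0 < d * n := Nat.mul_pos hd hn0
    rw [← hsd] at hs hpos
    exact hk1.ne (Nat.eq_of_mul_eq_mul_right hpos ((one_mul s).trans hs))
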